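/- Let $n\ge 1$, let $d\ge 2$ be a real number, and let $X_1,\dots,X_n\in L^d(\Omega,\mathcal F,\mathbf P)$ be real independent identically distributed random variables on a probability space, nondegenerate (i.e. not almost surely constant). Write $\vec X=(X_1,\dots,X_n)$. Let $\mathrm M_n$ be the space of complex $n\times n$ matrices and $\mathrm H_n$ the real vector space of Hermitian ones; for $A\in\mathrm H_n$ let $\vec\lambda(A)=(\lambda_1\ge\dots\ge\lambda_n)$ be its eigenvalues with multiplicity. For $1\le r\le d$ let $\mu_r=\mathbf E X_1^r$, $\mu_0=1$, and define the cumulants $\kappa_r$ by $\mu_r=\sum_{\ell=0}^{r-1}\binom{r-1}{\ell}\mu_\ell\kappa_{r-\ell}$ (if the moment generating function exists near $0$, these are the coefficients in $\log\mathbf E e^{tX_1}=\sum_{r\ge1}\kappa_r t^r/r!$). Let $B_\ell$ be the complete Bell polynomials, $\sum_{\ell\ge0}B_\ell(x_1,\dots,x_\ell)\,t^\ell/\ell!=\exp\big(\sum_{j\ge1}x_jt^j/j!\big)$. For a partition $\vec\pi=(\pi_1\ge\dots\ge\pi_r)$ of an integer, in which $i$ has multiplicity $m_i$, put $\kappa_{\vec\pi}=\kappa_{\pi_1}\cdots\kappa_{\pi_r}$,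 $y_{\vec\pi}=\prod_{i\ge1}(i!)^{m_i}m_i!$ and $p_{\vec\pi}(\vec\lambda)=\prod_{j=1}^r(\lambda_1^{\pi_j}+\dots+\lambda_n^{\pi_j})$, which is $\prod_{j=1}^r\operatorname{tr}A^{\pi_j}$ for $\vec\lambda=\vec\lambda(A)$. (a) For $A\in\mathrm H_n$ the expectation below is finite, and $$\|A\|_{\vec X,d}=\Big(\frac{\mathbf E|\langle\vec X,\vec\lambda(A)\rangle|^d}{\Gamma(d+1)}\Big)^{1/d}$$ is a norm on $\mathrm H_n$. (b) Suppose that $d$ is an even integer and that the $X_i$ have a moment generating function $M(t)=\mathbf E e^{tX_i}$, finite for $t$ near $0$. Then, for every $A\in\mathrm H_n$, $M_\Lambda(t)=\prod_{i=1}^nM(\lambda_it)$ is the moment generating function of $\Lambda=\langle\vec X,\vec\lambda(A)\rangle$, and $\|A\|_{\vec X,d}^d=[t^d]M_\Lambda(t)$, the coefficient of $t^d$ in its power series at $0$. In particular, $\|A\|_{\vec X,d}^d$ is the value at $\vec\lambda(A)$ of a symmetric polynomial on $\mathbb R^n$, homogeneous of degree $d$, that is positive except at $0$. (c) If $d$ is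 an even integer, then for every $A\in\mathrm H_n$ $$\|A\|_{\vec X,d}^d=\frac1{d!}B_d(\kappa_1\operatorname{tr}A,\kappa_2\operatorname{tr}A^2,\dots,\kappa_d\operatorname{tr}A^d)=\sum_{\vec\pi\vdash d}\frac{\kappa_{\vec\pi}\,p_{\vec\pi}(\vec\lambda(A))}{y_{\vec\pi}}.$$ (d) The function $\vec x\mapsto\big(\mathbf E|\langle\vec X,\vec x\rangle|^d/\Gamma(d+1)\big)^{1/d}$ on $\mathbb R^n$ is Schur convex: its value at $\vec x$ is at most its value at $\vec y$ whenever $\vec y$ majorizes $\vec x$, i.e. whenever $\sum_{i=1}^nx_i=\sum_{i=1}^ny_i$ and, for each $1\le k\le n$, the sum of the $k$ largest entries of $\vec x$ is at most that of $\vec y$. In particular, $\|A\|_{\vec X,d}\le\|B\|_{\vec X,d}$ for $A,B\in\mathrm H_n$ such that $\vec\lambda(B)$ majorizes $\vec\lambda(A)$. (e) Let $d$ be an even integer. For a partition $\vec\pi=(\pi_1,\dots,\pi_r)$ of $d$ and $Z\in\mathrm M_n$ let $\mathrm T_{\vec\pi}(Z)$ be $1/\binom d{d/2}$ times the sum over the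 $\binom d{d/2}$ ways to place $d/2$ adjoints ${}^*$ among the $d$ copies of $Z$ in $$(\operatorname{tr}\underbrace{ZZ\cdots Z}_{\pi_1})(\operatorname{tr}\underbrace{ZZ\cdots Z}_{\pi_2})\cdots(\operatorname{tr}\underbrace{ZZ\cdots Z}_{\pi_r}).$$ Then $\mathrm T_{\vec\pi}(Z)$ is real, the sum below is nonnegative, and $$\|Z\|_{\vec X,d}=\Big(\sum_{\vec\pi\vdash d}\frac{\kappa_{\vec\pi}\mathrm T_{\vec\pi}(Z)}{y_{\vec\pi}}\Big)^{1/d}$$ is a norm on the complex vector space $\mathrm M_n$ whose restriction to $\mathrm H_n$ is the norm in (a). In particular, $\|Z\|_{\vec X,d}^d$ is a real polynomial in traces of words in $Z$ and $Z^*$; it is continuous, and positive for $Z\ne0$. -/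

import Mathlib

open MeasureTheory ProbabilityTheory
open scoped BigOperators Topology Matrix Nat

namespace RandomNorm

/-- `N` is a norm on the `𝕜`-vector space `E`. -/
structure IsNorm (𝕜 : Type*) {E : Type*} [NormedField 𝕜] [AddCommGroup E] [Module 𝕜 E]
    (N : E → ℝ) : Prop where
  nonneg : ∀ x, 0 ≤ N x
  eq_zero_iff : ∀ x, N x = 0 ↔ x = 0
  smul : ∀ (c : 𝕜) (x : E), N (c • x) = ‖c‖ * N x
  add_le : ∀ x y, N (x + y) ≤ N x + N y

/-- A continuous real function that is positive everywhere, except perhaps at `0`. -/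
def IsPositiveDefinite {E : Type*} [TopologicalSpace E] [Zero E] (f : E → ℝ) : Prop :=
  Continuous f ∧ ∀ x, x ≠ 0 → 0 < f x

/-- The real vector space of `n × n` complex Hermitian matrices. -/
abbrev Herm (n : ℕ) : Type := selfAdjoint (Matrix (Fin n) (Fin n) ℂ)

/-- The eigenvalues of a Hermitian matrix, with multiplicity, in nonincreasing order. -/
noncomputable def eig {n : ℕ} (A : Herm n) : Fin n → ℝ := fun i =>
  Matrix.IsHermitian.eigenvalues₀ (A := (A : Matrix (Fin n) (Fin n) ℂ)) A.2
    (Fin.cast (Fintype.card_fin n).symm i)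

section Probability

variable {Ω : Type*} [MeasurableSpace Ω]

/-- The random variable `⟨X, x⟩ = x₁ X₁ + ⋯ + xₙ Xₙ`. -/
def pairing {n : ℕ} (X : Fin n → Ω → ℝ) (x : Fin n → ℝ) : Ω → ℝ :=
  fun ω => ∑ i, X i ω * x i

/-- `(𝔼 |⟨X, x⟩|ᵈ / Γ(d + 1))^(1/d)`, as a function of `x ∈ ℝⁿ`. -/
noncomputable def vecNorm {n : ℕ} (P : Measure Ω) (X : Fin n → Ω → ℝ) (d : ℝ)
    (x : Fin n → ℝ) : ℝ :=
  ((∫ ω, |pairing X x ω| ^ d ∂P) / Real.Gamma (d + 1)) ^ (1 / d)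

/-- `(𝔼 |⟨X, λ(A)⟩|ᵈ / Γ(d + 1))^(1/d)`, for Hermitian `A`. -/
noncomputable def hermNorm {n : ℕ} (P : Measure Ω) (X : Fin n → Ω → ℝ) (d : ℝ)
    (A : Herm n) : ℝ :=
  vecNorm P X d (eig A)

/-- The cumulants `κ_r` of a random variable, in terms of its moments `μ_r`, through
`μ_r = ∑_{ℓ = 0}^{r - 1} (r - 1 choose ℓ) μ_ℓ κ_{r - ℓ}` for `r ≥ 1`, where `μ_0 = 1`
(and `κ_0 = 0`). The term `ℓ = 0` is `κ_r`; the others are indexed by `ℓ = j + 1`. -/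
noncomputable def cumulant (P : Measure Ω) (X : Ω → ℝ) : ℕ → ℝ
  | 0 => 0
  | r + 1 => moment X (r + 1) P -
      ∑ j : Fin r, (r.choose (j + 1) : ℝ) * moment X (j + 1) P * cumulant P X (r - j)
  decreasing_by omega

theorem moment_eq_sum_cumulant (P : Measure Ω) [IsProbabilityMeasure P] (X : Ω → ℝ)
    (r : ℕ) (hr : 1 ≤ r) :
    moment X r P = ∑ l ∈ Finset.range r,
      ((r - 1).choose l : ℝ) * moment X l P * cumulant P X (r - l) := by
  obtain ⟨r, rfl⟩ : ∃ s, r = s + 1 := ⟨r - 1, by omega⟩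
  have h0 : moment X 0 P = 1 := by simp [moment]
  have hc := cumulant.eq_def P X (r + 1)
  simp only at hc
  rw [Fin.sum_univ_eq_sum_range
    (fun j => (r.choose (j + 1) : ℝ) * moment X (j + 1) P * cumulant P X (r - j)) r] at hc
  rw [Finset.sum_range_succ']
  simp only [h0, Nat.choose_zero_right, Nat.cast_one, Nat.sub_zero, add_tsub_cancel_right,
    one_mul, Nat.add_sub_add_right]
  rw [hc]
  ring

/-- If the moment generating function is finite near `0`, then the cumulants are the Taylor
coefficients (times `r!`) at `0` of its logarithm. -/
theorem cumulant_eq_iteratedDeriv_cgf (P : Measure Ω) [IsProbabilityMeasure P] (X : Ω → ℝ)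
    (h : 0 ∈ interior (integrableExpSet X P)) (r : ℕ) :
    cumulant P X r = iteratedDeriv r (cgf X P) 0 := by
  induction r using Nat.strong_induction_on with
  | _ r ih =>
  rcases r with _ | r
  · simp [cumulant]
  have hmom : ∀ l, iteratedDeriv l (mgf X P) 0 = moment X l P := fun l => by
    rw [iteratedDeriv_mgf_zero h]; rfl
  have hev : deriv (mgf X P) =ᶠ[𝓝 0] mgf X P * deriv (cgf X P) := by
    filter_upwards [isOpen_interior.eventually_mem h] with t ht
    rw [Pi.mul_apply, deriv_cgf ht, deriv_mgf ht,
      mul_div_cancel₀ _ (mgf_pos (interior_subset (s := integrableExpSet X P) ht)).ne']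
  have hK : ∀ j, iteratedDeriv j (deriv (cgf X P)) 0 = iteratedDeriv (j + 1) (cgf X P) 0 :=
    fun j => by rw [iteratedDeriv_succ']
  have hM : iteratedDeriv (r + 1) (mgf X P) 0 = ∑ l ∈ Finset.range (r + 1),
      (r.choose l : ℝ) * moment X l P * iteratedDeriv (r - l + 1) (cgf X P) 0 := by
    rw [iteratedDeriv_succ', hev.iteratedDeriv_eq r,
      iteratedDeriv_mul (analyticAt_mgf h).contDiffAt (analyticAt_cgf h).deriv.contDiffAt]
    exact Finset.sum_congr rfl fun l _ => by rw [hmom, hK]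
  have hA := moment_eq_sum_cumulant P X (r + 1) (by omega)
  rw [hmom, hA, Finset.sum_range_succ', Finset.sum_range_succ'] at hM
  have hs : ∀ l ∈ Finset.range r,
      ((r + 1 - 1).choose (l + 1) : ℝ) * moment X (l + 1) P * cumulant P X (r + 1 - (l + 1)) =
      (r.choose (l + 1) : ℝ) * moment X (l + 1) P *
        iteratedDeriv (r - (l + 1) + 1) (cgf X P) 0 := fun l hl => by
    have hl' := Finset.mem_range.mp hl
    rw [ih (r + 1 - (l + 1)) (by omega)]
    congr 2
    omega
  rw [Finset.sum_congr rfl hs] at hM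
  have h0 : moment X 0 P = 1 := by simp [moment]
  simpa [h0] using hM

end Probability

/-- `f` is the sum of a power series near `0`, in which the coefficient of `t ^ k` is `a`:
`[t ^ k] f(t) = a`. -/
def HasPowerSeriesCoeff (f : ℝ → ℝ) (k : ℕ) (a : ℝ) : Prop :=
  ∃ c : ℕ → ℝ, (∀ᶠ t in 𝓝 (0 : ℝ), HasSum (fun j => c j * t ^ j) (f t)) ∧ c k = a

/-- The complete Bell polynomials `B_ℓ(x₁, …, x_ℓ)`, with values in a commutative `ℚ`-algebra:
`∑ B_ℓ(x₁, …, x_ℓ) t^ℓ / ℓ! = exp (∑_{j ≥ 1} x_j t^j / j!)`, as formal power series in `t`. -/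
noncomputable def bell {R : Type*} [CommRing R] [Algebra ℚ R] (ℓ : ℕ) (x : ℕ → R) : R :=
  (ℓ ! : R) * PowerSeries.coeff ℓ ((PowerSeries.exp R).subst
    (PowerSeries.mk fun j => if j = 0 then 0 else algebraMap ℚ R (1 / (j ! : ℚ)) * x j))

section Partitions

variable {d : ℕ}

/-- `κ_π = κ_{π₁} κ_{π₂} ⋯ κ_{π_r}`. -/
def kappaPart (κ : ℕ → ℝ) (π : Nat.Partition d) : ℝ := (π.parts.map κ).prod

/-- `y_π = ∏_{i ≥ 1} (i!)^{m_i} m_i!`, where `m_i` is the multiplicity of `i` in `π`. -/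
def yPart (π : Nat.Partition d) : ℕ :=
  ∏ i ∈ π.parts.toFinset, i ! ^ π.parts.count i * (π.parts.count i)!

/-- `p_π(x) = p_{π₁}(x) ⋯ p_{π_r}(x)`, where `p_k` is the `k`th power sum. -/
noncomputable def psumPart {n : ℕ} (π : Nat.Partition d) (x : Fin n → ℝ) : ℝ :=
  (π.parts.map fun k => ∑ i, x i ^ k).prod

/-- `T_π(Z)`, for `π = (π₁ ≥ π₂ ≥ ⋯ ≥ π_r)`: the sum of `(tr w₁)(tr w₂) ⋯ (tr w_r)`, divided by
`d choose d/2`, over all words `w₁ w₂ ⋯ w_r` of length `d` that have `Zᴴ` in a set `S` of `d / 2`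
places and `Z` in the others, cut into consecutive blocks of lengths `π₁, …, π_r`. -/
noncomputable def tracePart {n : ℕ} (π : Nat.Partition d) (Z : Matrix (Fin n) (Fin n) ℂ) : ℂ :=
  (∑ S ∈ Finset.powersetCard (d / 2) (Finset.univ : Finset (Fin d)),
    (((π.parts.sort (· ≥ ·)).splitLengths
      (List.ofFn fun i : Fin d => if i ∈ S then Zᴴ else Z)).map
        fun w => w.prod.trace).prod) / (d.choose (d / 2) : ℂ)

end Partitions

/-- `(∑_{π ⊢ d} κ_π T_π(Z) / y_π)^(1/d)` (the numbers `T_π(Z)` are real for even `d`). -/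
noncomputable def matNorm {n : ℕ} (κ : ℕ → ℝ) (d : ℕ) (Z : Matrix (Fin n) (Fin n) ℂ) : ℝ :=
  (∑ π : Nat.Partition d, kappaPart κ π * (tracePart π Z).re / (yPart π : ℝ)) ^ (1 / (d : ℝ))

/-- The value at `Z` of a word in the letters `x` (`true`) and `x*` (`false`). -/
noncomputable def evalWord {n : ℕ} (Z : Matrix (Fin n) (Fin n) ℂ) :
    FreeMonoid Bool →* Matrix (Fin n) (Fin n) ℂ :=
  FreeMonoid.lift fun b => if b then Z else Zᴴ

/-- `f(Z)` is a polynomial with real coefficients in traces of words in `Z` and `Zᴴ`. -/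
def IsTracePolynomial {n : ℕ} (f : Matrix (Fin n) (Fin n) ℂ → ℝ) : Prop :=
  ∃ q : MvPolynomial (FreeMonoid Bool) ℝ, ∀ Z,
    (f Z : ℂ) = MvPolynomial.aeval (fun w => (evalWord Z w).trace) q

/-- `∑_{i ≤ k} x̃_i`, where `x̃` is the nonincreasing rearrangement of `x`. -/
noncomputable def topSum {n : ℕ} (x : Fin n → ℝ) (k : ℕ) : ℝ :=
  ∑ i : Fin n with i.val < k, x (Tuple.sort x i.rev)

/-- `y` majorizes `x`. -/
def Majorizes {n : ℕ} (y x : Fin n → ℝ) : Prop :=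
  ∑ i, x i = ∑ i, y i ∧ ∀ k, 1 ≤ k → k ≤ n → topSum x k ≤ topSum y k

/-- Schur convexity: `f x ≤ f y` whenever `y` majorizes `x`. -/
def SchurConvex {n : ℕ} (f : (Fin n → ℝ) → ℝ) : Prop :=
  ∀ x y, Majorizes y x → f x ≤ f y

end RandomNorm

namespace RandomNorm

/-! Up to a constant, `vecNorm` is the `L^d` norm of the random variable `⟨X, x⟩`, which is linear
in `x`. Minkowski's inequality makes it a seminorm. It is definite because `⟨X, x⟩` has variance `∑
x_i² Var X_i`, with every `Var X_i > 0`. As the `X_i` are independent and identically distributed,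
it is invariant under permutations of coordinates.

Convexity and symmetry give (d) and the rest of (a). A symmetric norm `N` on `ℝⁿ` cannot increase on
passing from `y` to a point of the convex hull of the permutations of `y`. By Rado's theorem
(`Majorizes.mem_convexHull_perm`) this is Schur convexity. By Schur's theorem
(`conjDiag_mem_convexHull`) the diagonal of `Uᴴ A U` lies in the hull of the permutations of the
spectrum of `A`. So `N (eig A)` is the maximum over unitary `U` of `N (diag (Uᴴ A U))`, and a
maximum of seminorms is subadditive.

For even `d` the `d`th power is `𝔼 ⟨X, x⟩^d / d!`, the coefficient of `t^d` in the product over `i`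
of the formal moment series of `x_i X_i`. The recurrence that defines the cumulants says that the
moment series has logarithmic derivative `∑ κ_{j+1} t^j / j!`. The Bell series and the series of
partition sums have logarithmic derivatives of the same shape, and `HasLogDeriv.unique` identifies
them. No convergence is needed, so (c) holds without a moment generating function.

For (e), expand `tr` products of powers of `uZ + ūZᴴ` into words. A word with `s` adjoints carries
`u^(d-2s)` when `|u| = 1`, so averaging over the `(d+1)`th roots of unity keeps exactly the words
with `d/2` adjoints. Hence `‖Z‖^d` is a positive multiple of `∑_k ‖ω^k Z + ω^(-k) Zᴴ‖^d`, the `d`th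
power of an `ℓ^d` norm of Hermitian norms. -/

theorem pairing_add {Ω : Type*} {n : ℕ} (X : Fin n → Ω → ℝ) (x y : Fin n → ℝ) :
    pairing X (x + y) = pairing X x + pairing X y := by
  ext ω
  simp [pairing, mul_add, Finset.sum_add_distrib]

theorem pairing_smul {Ω : Type*} {n : ℕ} (X : Fin n → Ω → ℝ) (c : ℝ) (x : Fin n → ℝ) :
    pairing X (c • x) = c • pairing X x := by
  ext ω
  simp only [pairing, Pi.smul_apply, smul_eq_mul, Finset.mul_sum]
  exact Finset.sum_congr rfl fun i _ => by ring

/-! ### The norm on `ℝⁿ` as a scaled `L^d` norm. -/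

section VectorNorm

variable {Ω : Type*} [MeasurableSpace Ω] {P : Measure Ω} {n : ℕ} {X : Fin n → Ω → ℝ} {d : ℝ}

theorem memLp_pairing {p : ENNReal} (hX : ∀ i, MemLp (X i) p P) (x : Fin n → ℝ) :
    MemLp (pairing X x) p P :=
  memLp_finsetSum _ fun i _ => (hX i).mul_const (x i)

theorem integrable_abs_pairing_rpow (hd : 0 < d) (hX : ∀ i, MemLp (X i) (ENNReal.ofReal d) P)
    (x : Fin n → ℝ) : Integrable (fun ω => |pairing X x ω| ^ d) P := by
  have h := (memLp_pairing hX x).integrable_norm_rpow (by simpa using hd) (by simp)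
  simpa [ENNReal.toReal_ofReal hd.le] using h

theorem vecNorm_eq_eLpNorm (hd : 0 < d) (hX : ∀ i, MemLp (X i) (ENNReal.ofReal d) P)
    (x : Fin n → ℝ) :
    vecNorm P X d x =
      (eLpNorm (pairing X x) (ENNReal.ofReal d) P).toReal / Real.Gamma (d + 1) ^ (1 / d) := by
  have h0 : 0 ≤ ∫ ω, |pairing X x ω| ^ d ∂P := integral_nonneg fun ω => by positivity
  rw [(memLp_pairing hX x).eLpNorm_eq_integral_rpow_norm (by simpa using hd) (by simp),
    ENNReal.toReal_ofReal (by positivity), vecNorm,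
    Real.div_rpow h0 (Real.Gamma_pos_of_pos (by positivity)).le]
  simp [ENNReal.toReal_ofReal hd.le]

/-- Variances of independent variables add, so a null combination forces `∑ x_i² Var X_i = 0`;
nondegeneracy makes each `Var X_i` positive. -/
theorem eq_zero_of_pairing_ae_eq_zero [IsProbabilityMeasure P] (hX : ∀ i, MemLp (X i) 2 P)
    (hnondeg : ∀ i, ∀ c : ℝ, ¬ (X i =ᵐ[P] fun _ => c)) (hindep : iIndepFun X P)
    {x : Fin n → ℝ} (h : pairing X x =ᵐ[P] 0) : x = 0 := by
  have hvar : variance (pairing X x) P = ∑ i, x i ^ 2 * variance (X i) P := by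
    have hsum : pairing X x = ∑ i, fun ω => x i * X i ω := by
      ext ω
      simp [pairing, mul_comm]
    rw [hsum, IndepFun.variance_sum (fun i _ => (hX i).const_mul (x i))]
    · simp [variance_const_mul]
    · intro i _ j _ hij
      exact (hindep.indepFun hij).comp (measurable_const_mul (x i)) (measurable_const_mul (x j))
  have hzero : variance (pairing X x) P = 0 := by
    rw [variance_congr h]
    exact variance_zero P
  rw [hzero] at hvar
  have hpos : ∀ i, 0 < variance (X i) P := fun i => by
    refine lt_of_le_of_ne (variance_nonneg _ _) fun h0 => hnondeg i (∫ ω, X i ω ∂P) ?_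
    rw [← evariance_eq_zero_iff (hX i).aestronglyMeasurable.aemeasurable,
      ← (hX i).ofReal_variance_eq, ← h0, ENNReal.ofReal_zero]
  have := (Finset.sum_eq_zero_iff_of_nonneg fun i _ =>
    mul_nonneg (sq_nonneg (x i)) (hpos i).le).1 hvar.symm
  ext i
  simpa [(hpos i).ne'] using this i (Finset.mem_univ i)

theorem isNorm_vecNorm [IsProbabilityMeasure P] (hd : 2 ≤ d)
    (hLd : ∀ i, MemLp (X i) (ENNReal.ofReal d) P)
    (hnondeg : ∀ i, ∀ c : ℝ, ¬ (X i =ᵐ[P] fun _ => c)) (hindep : iIndepFun X P) :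
    IsNorm ℝ (vecNorm P X d) := by
  have hd0 : 0 < d := by linarith
  have hΓ : 0 < Real.Gamma (d + 1) ^ (1 / d) :=
    Real.rpow_pos_of_pos (Real.Gamma_pos_of_pos (by positivity)) _
  have hfin : ∀ x, eLpNorm (pairing X x) (ENNReal.ofReal d) P ≠ ⊤ :=
    fun x => (memLp_pairing hLd x).eLpNorm_ne_top
  have hmeas : ∀ x, AEStronglyMeasurable (pairing X x) P :=
    fun x => (memLp_pairing hLd x).aestronglyMeasurable
  refine ⟨fun x => ?_, fun x => ?_, fun c x => ?_, fun x y => ?_⟩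
  · rw [vecNorm_eq_eLpNorm hd0 hLd]
    positivity
  · rw [vecNorm_eq_eLpNorm hd0 hLd]
    constructor
    · intro h
      rw [div_eq_zero_iff, or_iff_left hΓ.ne', ENNReal.toReal_eq_zero_iff, or_iff_left (hfin x),
        eLpNorm_eq_zero_iff (hmeas x) (by simpa using hd0)] at h
      -- Here `d ≥ 2` matters: on a probability space `L^d ⊆ L²`, so variances are available.
      refine eq_zero_of_pairing_ae_eq_zero (fun i => (hLd i).mono_exponent ?_) hnondeg hindep h
      exact ENNReal.le_ofReal_iff_toReal_le (by simp) hd0.le |>.2 (by simpa using hd)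
    · rintro rfl
      have : pairing X (0 : Fin n → ℝ) = 0 := by ext; simp [pairing]
      simp [this]
  · rw [vecNorm_eq_eLpNorm hd0 hLd, vecNorm_eq_eLpNorm hd0 hLd, pairing_smul, eLpNorm_const_smul,
      ENNReal.toReal_mul, mul_div_assoc]
    simp
  · rw [vecNorm_eq_eLpNorm hd0 hLd, vecNorm_eq_eLpNorm hd0 hLd, vecNorm_eq_eLpNorm hd0 hLd,
      pairing_add, ← add_div, ← ENNReal.toReal_add (hfin x) (hfin y)]
    gcongr
    · exact ENNReal.add_ne_top.2 ⟨hfin x, hfin y⟩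
    · exact eLpNorm_add_le (hmeas x) (hmeas y) (by simpa using by linarith)

/-- An independent identically distributed family is exchangeable: permuting it leaves the joint law
unchanged. -/
theorem vecNorm_comp_perm (hindep : iIndepFun X P)
    (hident : ∀ i j, IdentDistrib (X i) (X j) P P) (d : ℝ) (σ : Equiv.Perm (Fin n))
    (x : Fin n → ℝ) : vecNorm P X d (x ∘ σ) = vecNorm P X d x := by
  have h : IdentDistrib (fun ω i => X i ω) (fun ω i => X (σ.symm i) ω) P P :=
    IdentDistrib.pi (fun i => hident i (σ.symm i)) hindep (hindep.precomp σ.symm.injective)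
  have hu : Measurable fun v : Fin n → ℝ => |∑ i, v i * x i| ^ d := by fun_prop
  have := (h.comp hu).integral_eq
  simp only [vecNorm]
  congr 2
  refine Eq.trans ?_ this.symm
  refine integral_congr_ae (.of_forall fun ω => ?_)
  simp only [pairing, Function.comp_apply]
  congr 2
  exact Fintype.sum_equiv σ _ _ fun i => by simp

end VectorNorm

/-! ### Majorization and permutation-invariant norms. -/

section SymmetricNorm

variable {n : ℕ} {N : (Fin n → ℝ) → ℝ}

theorem IsNorm.convexOn {E : Type*} [AddCommGroup E] [Module ℝ E] {N : E → ℝ}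
    (hN : IsNorm ℝ N) : ConvexOn ℝ Set.univ N := by
  refine ⟨convex_univ, fun x _ y _ a b ha hb _ => (hN.add_le _ _).trans ?_⟩
  rw [hN.smul, hN.smul, Real.norm_of_nonneg ha, Real.norm_of_nonneg hb, smul_eq_mul, smul_eq_mul]

theorem IsNorm.le_of_mem_convexHull_perm (hN : IsNorm ℝ N)
    (hperm : ∀ (σ : Equiv.Perm (Fin n)) x, N (x ∘ σ) = N x) {x y : Fin n → ℝ}
    (h : y ∈ convexHull ℝ (Set.range fun σ : Equiv.Perm (Fin n) => x ∘ σ)) : N y ≤ N x := by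
  have hsub : Set.range (fun σ : Equiv.Perm (Fin n) => x ∘ σ) ⊆ {z | z ∈ Set.univ ∧ N z ≤ N x} := by
    rintro _ ⟨σ, rfl⟩
    exact ⟨trivial, (hperm σ x).le⟩
  exact (convexHull_min hsub (hN.convexOn.convex_le (N x)) h).2

/-- Birkhoff's theorem, carried over by the linear map `M ↦ M *ᵥ x`. -/
theorem mulVec_mem_convexHull_perm {M : Matrix (Fin n) (Fin n) ℝ}
    (hM : M ∈ doublyStochastic ℝ (Fin n)) (x : Fin n → ℝ) :
    M *ᵥ x ∈ convexHull ℝ (Set.range fun σ : Equiv.Perm (Fin n) => x ∘ σ) := by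
  have h : M ∈ (doublyStochastic ℝ (Fin n) : Set (Matrix (Fin n) (Fin n) ℝ)) := hM
  rw [doublyStochastic_eq_convexHull_permMatrix] at h
  have hx := Set.mem_image_of_mem ((Matrix.mulVecBilin ℝ ℝ).flip x) h
  rw [LinearMap.image_convexHull] at hx
  refine convexHull_mono ?_ hx
  rintro _ ⟨_, ⟨σ, rfl⟩, rfl⟩
  exact ⟨σ, (Matrix.permMatrix_mulVec σ).symm⟩

/-- The nonincreasing rearrangement of `x`. -/
noncomputable def rearrange (x : Fin n → ℝ) : Fin n → ℝ :=
  x ∘ Fin.revPerm.trans (Tuple.sort x)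

theorem rearrange_antitone (x : Fin n → ℝ) : Antitone (rearrange x) :=
  fun _ _ h => Tuple.monotone_sort x (Fin.rev_le_rev.2 h)

/-- Abel summation, done by induction: the decreasing weights meet nonnegative partial sums. -/
theorem mul_sum_le_sum_mul_of_antitone (a z : ℕ → ℝ) (m : ℕ)
    (ha : ∀ i < m, a (i + 1) ≤ a i) (hz : ∀ k ≤ m + 1, 0 ≤ ∑ i ∈ Finset.range k, z i) :
    a m * ∑ i ∈ Finset.range (m + 1), z i ≤ ∑ i ∈ Finset.range (m + 1), a i * z i := by
  induction m with
  | zero => simp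
  | succ m ih =>
    rw [Finset.sum_range_succ, Finset.sum_range_succ (fun i => a i * z i), mul_add]
    gcongr
    refine le_trans ?_ (ih (fun i hi => ha i (by omega)) fun k hk => hz k (by omega))
    exact mul_le_mul_of_nonneg_right (ha m (by omega)) (hz _ (by omega))

theorem sum_mul_le_sum_mul_of_partial_sums_le {a x y : Fin n → ℝ} (ha : Antitone a)
    (hxy : ∀ k ≤ n, ∑ i with i.val < k, x i ≤ ∑ i with i.val < k, y i)
    (hsum : ∑ i, x i = ∑ i, y i) : ∑ i, a i * x i ≤ ∑ i, a i * y i := by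
  rcases n with _ | m
  · simp
  let a' : ℕ → ℝ := fun i => if h : i < m + 1 then a ⟨i, h⟩ else 0
  let z' : ℕ → ℝ := fun i => if h : i < m + 1 then y ⟨i, h⟩ - x ⟨i, h⟩ else 0
  have hz : ∀ i : Fin (m + 1), z' i = y i - x i := fun i => by simp only [z', i.2, dif_pos]
  have ha' : ∀ i : Fin (m + 1), a' i = a i := fun i => by simp only [a', i.2, dif_pos]
  -- Applied to the differences `y - x`, whose total is zero, so that the left side of `key`
  -- vanishes whatever the sign of the last weight.
  have key := mul_sum_le_sum_mul_of_antitone a' z' m ?_ ?_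
  · rw [← Fin.sum_univ_eq_sum_range (fun i => a' i * z' i),
      ← Fin.sum_univ_eq_sum_range (fun i => z' i)] at key
    simp only [hz, ha', Finset.sum_sub_distrib, mul_sub, hsum] at key
    linarith
  · intro i hi
    have h1 : i < m + 1 := by omega
    have h2 : i + 1 < m + 1 := by omega
    simp only [a', h1, h2, dif_pos]
    exact ha (Fin.mk_le_mk.2 (by omega))
  · intro k hk
    have hsplit : ∑ i ∈ Finset.range k, z' i = ∑ i : Fin (m + 1) with i.val < k, z' i := by
      rw [Finset.sum_filter, Fin.sum_univ_eq_sum_range (fun i => if i < k then z' i else 0),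
        ← Finset.sum_filter]
      congr 1
      ext i
      simp only [Finset.mem_range, Finset.mem_filter]
      omega
    rw [hsplit]
    simp only [hz, Finset.sum_sub_distrib]
    linarith [hxy k hk]

theorem sum_mul_le_sum_rearrange_mul (c x : Fin n → ℝ) :
    ∑ i, c i * x i ≤ ∑ i, rearrange c i * rearrange x i := by
  set σ := Fin.revPerm.trans (Tuple.sort c)
  set τ := Fin.revPerm.trans (Tuple.sort x)
  have hm : Monovary (rearrange c) (rearrange x) :=
    (rearrange_antitone c).monovary (rearrange_antitone x)
  refine le_of_eq_of_le ?_ (hm.sum_mul_comp_perm_le_sum_mul (σ := σ.trans τ.symm))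
  refine (Fintype.sum_equiv σ _ _ fun i => ?_).symm
  change c (σ i) * x (τ (τ.symm (σ i))) = _
  rw [Equiv.apply_symm_apply]

/-- Rado's theorem, in one direction. -/
theorem Majorizes.mem_convexHull_perm {x y : Fin n → ℝ} (h : Majorizes y x) :
    x ∈ convexHull ℝ (Set.range fun σ : Equiv.Perm (Fin n) => y ∘ σ) := by
  by_contra hx
  -- If `x` were outside the hull, a functional `f = ⟨c, ·⟩` would separate it strictly. But some
  -- permutation of `y` gives `f` the value `⟨c↓, y↓⟩`, and `f x ≤ ⟨c↓, x↓⟩ ≤ ⟨c↓, y↓⟩` by the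
  -- rearrangement inequality and Abel summation.
  obtain ⟨f, u, hf, hu⟩ := geometric_hahn_banach_closed_point (convex_convexHull ℝ _)
    ((Set.finite_range fun σ : Equiv.Perm (Fin n) => y ∘ σ).isClosed_convexHull ℝ) hx
  let c : Fin n → ℝ := fun i => f (Pi.single i 1)
  have hc : ∀ v, f v = ∑ i, c i * v i := fun v => by
    conv_lhs => rw [← Finset.univ_sum_single v]
    rw [map_sum]
    refine Finset.sum_congr rfl fun i _ => ?_
    rw [show Pi.single i (v i) = v i • (Pi.single i (1 : ℝ) : Fin n → ℝ) by
      rw [← Pi.single_smul, smul_eq_mul, mul_one], map_smul, smul_eq_mul, mul_comm]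
  set σ := Fin.revPerm.trans (Tuple.sort c)
  set τ := Fin.revPerm.trans (Tuple.sort y)
  have hyf : f (y ∘ (σ.symm.trans τ)) = ∑ i, rearrange c i * rearrange y i := by
    rw [hc]
    refine (Fintype.sum_equiv σ _ _ fun i => ?_).symm
    change c (σ i) * y (τ i) = c (σ i) * y (τ (σ.symm (σ i)))
    rw [Equiv.symm_apply_apply]
  have h1 : f x ≤ ∑ i, rearrange c i * rearrange x i := by
    rw [hc]
    exact sum_mul_le_sum_rearrange_mul c x
  have hre : ∀ z : Fin n → ℝ, ∑ i, rearrange z i = ∑ i, z i := fun z =>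
    Equiv.sum_comp (Fin.revPerm.trans (Tuple.sort z)) z
  have h2 : ∑ i, rearrange c i * rearrange x i ≤ ∑ i, rearrange c i * rearrange y i := by
    refine sum_mul_le_sum_mul_of_partial_sums_le (rearrange_antitone c) (fun k hk => ?_) ?_
    · rcases Nat.eq_zero_or_pos k with rfl | hk'
      · simp
      · exact h.2 k hk' hk
    · rw [hre, hre, h.1]
  have h3 := hf _ (subset_convexHull ℝ _ ⟨σ.symm.trans τ, rfl⟩)
  dsimp only at h3
  linarith

theorem IsNorm.schurConvex (hN : IsNorm ℝ N)
    (hperm : ∀ (σ : Equiv.Perm (Fin n)) x, N (x ∘ σ) = N x) : SchurConvex N :=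
  fun _ _ h => hN.le_of_mem_convexHull_perm hperm h.mem_convexHull_perm

end SymmetricNorm

/-! ### From symmetric norms on `ℝⁿ` to norms on Hermitian matrices. -/

section Spectral

variable {n : ℕ} {N : (Fin n → ℝ) → ℝ}

theorem Herm.isHermitian (A : Herm n) : (A : Matrix (Fin n) (Fin n) ℂ).IsHermitian := A.2

theorem exists_eig_eq_eigenvalues_comp (A : Herm n) :
    ∃ σ : Equiv.Perm (Fin n), eig A =
      A.isHermitian.eigenvalues ∘ σ := by
  refine ⟨(finCongr (Fintype.card_fin n).symm).trans
    (Fintype.equivOfCardEq (Fintype.card_fin _)), ?_⟩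
  ext i
  simp [eig, Matrix.IsHermitian.eigenvalues]

theorem normSq_entries_mem_doublyStochastic {V : Matrix (Fin n) (Fin n) ℂ}
    (hV : V ∈ Matrix.unitaryGroup (Fin n) ℂ) :
    (Matrix.of fun i j => Complex.normSq (V i j)) ∈ doublyStochastic ℝ (Fin n) := by
  rw [mem_doublyStochastic_iff_sum]
  refine ⟨fun i j => Complex.normSq_nonneg _, fun i => ?_, fun j => ?_⟩
  · have h := congrFun (congrFun (Matrix.mem_unitaryGroup_iff.1 hV) i) i
    rw [Matrix.mul_apply, Matrix.one_apply_eq] at h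
    have h' := congrArg Complex.re h
    simpa [Matrix.star_apply, Complex.mul_conj, ← Complex.ofReal_sum] using h'
  · have h := congrFun (congrFun (Matrix.mem_unitaryGroup_iff'.1 hV) j) j
    rw [Matrix.mul_apply, Matrix.one_apply_eq] at h
    have h' := congrArg Complex.re h
    simpa [Matrix.star_apply, mul_comm, Complex.mul_conj, ← Complex.ofReal_sum] using h'

/-- The real parts of the diagonal entries of `Uᴴ A U`. -/
def conjDiag (U A : Matrix (Fin n) (Fin n) ℂ) : Fin n → ℝ := fun i => ((star U * A * U) i i).re

theorem conjDiag_add (U A B : Matrix (Fin n) (Fin n) ℂ) :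
    conjDiag U (A + B) = conjDiag U A + conjDiag U B := by
  ext i
  simp [conjDiag, mul_add, add_mul]

theorem conjDiag_smul (U A : Matrix (Fin n) (Fin n) ℂ) (c : ℝ) :
    conjDiag U (c • A) = c • conjDiag U A := by
  ext i
  simp [conjDiag]

theorem conjDiag_eigenvectorUnitary {A : Matrix (Fin n) (Fin n) ℂ} (hA : A.IsHermitian) :
    conjDiag (hA.eigenvectorUnitary : Matrix (Fin n) (Fin n) ℂ) A = hA.eigenvalues := by
  ext i
  have h := hA.conjStarAlgAut_star_eigenvectorUnitary
  rw [Unitary.conjStarAlgAut_apply] at h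
  simp only [Unitary.coe_star, star_star] at h
  simp [conjDiag, h]

/-- Schur's theorem: in an eigenbasis the diagonal entries are averages of the eigenvalues with
weights `|V i j|²`, a doubly stochastic matrix. -/
theorem conjDiag_mem_convexHull {A : Matrix (Fin n) (Fin n) ℂ} (hA : A.IsHermitian)
    {U : Matrix (Fin n) (Fin n) ℂ} (hU : U ∈ Matrix.unitaryGroup (Fin n) ℂ) :
    conjDiag U A ∈
      convexHull ℝ (Set.range fun σ : Equiv.Perm (Fin n) => hA.eigenvalues ∘ σ) := by
  set W := hA.eigenvectorUnitary
  have hV : star U * (W : Matrix (Fin n) (Fin n) ℂ) ∈ Matrix.unitaryGroup (Fin n) ℂ :=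
    mul_mem (Unitary.star_mem hU) W.2
  set V := star U * (W : Matrix (Fin n) (Fin n) ℂ)
  convert mulVec_mem_convexHull_perm (normSq_entries_mem_doublyStochastic hV) hA.eigenvalues
  have h : star U * A * U = V * Matrix.diagonal (RCLike.ofReal ∘ hA.eigenvalues) * star V := by
    conv_lhs => rw [hA.spectral_theorem, Unitary.conjStarAlgAut_apply]
    simp [V, W, mul_assoc]
  ext i
  simp only [conjDiag, h, Matrix.mulVec, dotProduct, Matrix.of_apply]
  rw [Matrix.mul_apply, Complex.re_sum]
  refine Finset.sum_congr rfl fun j _ => ?_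
  rw [Matrix.mul_diagonal, Matrix.star_apply, mul_right_comm, Complex.star_def, Complex.mul_conj]
  simp

/-- `N (eig A)` bounds `N (conjDiag U A)` for all unitary `U`, with equality at an eigenvector
basis. Choosing `U` optimal for `A + B` gives the triangle inequality. -/
theorem IsNorm.isNorm_comp_eig (hN : IsNorm ℝ N)
    (hperm : ∀ (σ : Equiv.Perm (Fin n)) x, N (x ∘ σ) = N x) :
    IsNorm ℝ fun A : Herm n => N (eig A) := by
  have heig : ∀ A : Herm n, N (eig A) =
      N (A.isHermitian.eigenvalues) := fun A => by
    obtain ⟨σ, hσ⟩ := exists_eig_eq_eigenvalues_comp A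
    rw [hσ, hperm]
  have hle : ∀ (A : Herm n) (U : Matrix.unitaryGroup (Fin n) ℂ),
      N (conjDiag (U : Matrix (Fin n) (Fin n) ℂ) A) ≤ N (eig A) := fun A U => by
    rw [heig]
    exact hN.le_of_mem_convexHull_perm hperm (conjDiag_mem_convexHull A.isHermitian U.2)
  have hex : ∀ A : Herm n, ∃ U : Matrix.unitaryGroup (Fin n) ℂ,
      N (eig A) = N (conjDiag (U : Matrix (Fin n) (Fin n) ℂ) A) := fun A =>
    ⟨_, by rw [heig, ← conjDiag_eigenvectorUnitary A.isHermitian]⟩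
  have hsmul : ∀ (c : ℝ) (A : Herm n), N (eig (c • A)) ≤ ‖c‖ * N (eig A) := fun c A => by
    obtain ⟨U, hU⟩ := hex (c • A)
    rw [hU, selfAdjoint.val_smul, conjDiag_smul, hN.smul]
    exact mul_le_mul_of_nonneg_left (hle A U) (norm_nonneg c)
  have hdef : ∀ A : Herm n, N (eig A) = 0 ↔ A = 0 := fun A => by
    rw [heig, hN.eq_zero_iff, Matrix.IsHermitian.eigenvalues_eq_zero_iff]
    exact ZeroMemClass.coe_eq_zero
  refine ⟨fun A => hN.nonneg _, hdef, fun c A => ?_, fun A B => ?_⟩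
  · rcases eq_or_ne c 0 with rfl | hc
    · simp [hdef]
    · refine (hsmul c A).antisymm ?_
      -- The reverse inequality comes from scaling back by `c⁻¹`.
      have h := hsmul c⁻¹ (c • A)
      rw [inv_smul_smul₀ hc, norm_inv] at h
      rwa [← le_inv_mul_iff₀ (norm_pos_iff.2 hc)]
  · obtain ⟨U, hU⟩ := hex (A + B)
    rw [hU, AddSubgroup.coe_add, conjDiag_add]
    exact (hN.add_le _ _).trans (add_le_add (hle A U) (hle B U))

end Spectral

/-! ### Formal power series determined by their logarithmic derivative. -/

section PowerSeries

variable {R : Type*} [Field R]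

/-- The logarithmic derivative of `F` is `H`, and `F(0) = 1`. -/
structure HasLogDeriv (F H : PowerSeries R) : Prop where
  constantCoeff : PowerSeries.constantCoeff F = 1
  derivative : PowerSeries.derivative R F = F * H

/-- Comparing coefficients of `t^r` in `F' = F H` expresses `(r + 1) F_{r+1}` through `F_0, …, F_r`;
in characteristic zero this determines `F`. -/
theorem HasLogDeriv.unique [CharZero R] {F G H : PowerSeries R} (hF : HasLogDeriv F H)
    (hG : HasLogDeriv G H) : F = G := by
  ext r
  induction r using Nat.strong_induction_on with
  | _ r ih =>
  rcases r with _ | r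
  · simp [hF.constantCoeff, hG.constantCoeff]
  have h1 := congrArg (PowerSeries.coeff r) hF.derivative
  have h2 := congrArg (PowerSeries.coeff r) hG.derivative
  rw [PowerSeries.coeff_derivative, PowerSeries.coeff_mul] at h1 h2
  have h3 : PowerSeries.coeff (r + 1) F * (r + 1) = PowerSeries.coeff (r + 1) G * (r + 1) := by
    rw [h1, h2]
    refine Finset.sum_congr rfl fun p hp => ?_
    rw [ih p.1 (by have := Finset.HasAntidiagonal.mem_antidiagonal.1 hp; omega)]
  exact mul_right_cancel₀ (Nat.cast_add_one_ne_zero r) h3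

theorem HasLogDeriv.prod {ι : Type*} (s : Finset ι) {F H : ι → PowerSeries R}
    (h : ∀ i ∈ s, HasLogDeriv (F i) (H i)) : HasLogDeriv (∏ i ∈ s, F i) (∑ i ∈ s, H i) := by
  classical
  induction s using Finset.induction_on with
  | empty => exact ⟨by simp, by simp⟩
  | insert a s ha ih =>
    have h1 := h a (Finset.mem_insert_self a s)
    have h2 := ih fun i hi => h i (Finset.mem_insert_of_mem hi)
    rw [Finset.prod_insert ha, Finset.sum_insert ha]
    refine ⟨by rw [map_mul, h1.constantCoeff, h2.constantCoeff, mul_one], ?_⟩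
    rw [Derivation.leibniz, h1.derivative, h2.derivative, smul_eq_mul, smul_eq_mul]
    ring

/-- `∑ x_{j + 1} t^j / j!`, the derivative of `∑ x_j t^j / j!`. -/
noncomputable def egfDeriv (x : ℕ → R) : PowerSeries R :=
  PowerSeries.mk fun j => x (j + 1) / (j ! : R)

theorem derivative_mk_div_factorial [CharZero R] (x : ℕ → R) :
    PowerSeries.derivative R (PowerSeries.mk fun j => x j / (j ! : R)) = egfDeriv x := by
  ext j
  rw [PowerSeries.coeff_derivative, egfDeriv, PowerSeries.coeff_mk, PowerSeries.coeff_mk,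
    Nat.factorial_succ]
  have : (j ! : R) ≠ 0 := Nat.cast_ne_zero.2 j.factorial_ne_zero
  have : (j + 1 : R) ≠ 0 := Nat.cast_add_one_ne_zero j
  push_cast
  field_simp

theorem sum_egfDeriv {ι : Type*} (s : Finset ι) (x : ι → ℕ → R) :
    ∑ i ∈ s, egfDeriv (x i) = egfDeriv fun j => ∑ i ∈ s, x i j := by
  ext j
  simp [egfDeriv, Finset.sum_div]

theorem hasLogDeriv_exp_subst [CharZero R] [Algebra ℚ R] (x : ℕ → R) :
    HasLogDeriv ((PowerSeries.exp R).subst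
      (PowerSeries.mk fun j => if j = 0 then 0 else algebraMap ℚ R (1 / (j ! : ℚ)) * x j))
      (egfDeriv x) := by
  set F : PowerSeries R :=
    PowerSeries.mk fun j => if j = 0 then 0 else algebraMap ℚ R (1 / (j ! : ℚ)) * x j with hF
  have h0 : PowerSeries.constantCoeff F = 0 := by
    rw [← PowerSeries.coeff_zero_eq_constantCoeff_apply, hF, PowerSeries.coeff_mk, if_pos rfl]
  have hs : PowerSeries.HasSubst F := PowerSeries.HasSubst.of_constantCoeff_zero' h0
  constructor
  · have h1 : PowerSeries.exp R = (PowerSeries.exp R - 1) + 1 := by ring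
    have h2 : PowerSeries.constantCoeff ((PowerSeries.exp R - 1).subst F) = 0 :=
      PowerSeries.constantCoeff_subst_eq_zero h0 _ (by simp)
    rw [h1, PowerSeries.subst_add hs, map_add, h2, ← PowerSeries.coe_substAlgHom hs, map_one,
      map_one, zero_add]
  · rw [PowerSeries.derivative_subst hs, PowerSeries.derivative_exp]
    congr 1
    have : F = PowerSeries.mk fun j => (if j = 0 then 0 else x j) / (j ! : R) := by
      ext j
      rw [hF, PowerSeries.coeff_mk, PowerSeries.coeff_mk]
      split_ifs
      · simp
      · rw [map_div₀, map_one, map_natCast]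
        ring
    rw [this, derivative_mk_div_factorial]
    ext j
    simp [egfDeriv]

/-- The moment-cumulant recurrence is `F' = F H`, read coefficientwise after division by `r!`. -/
theorem hasLogDeriv_of_recurrence [CharZero R] {μ κ : ℕ → R} (h0 : μ 0 = 1)
    (h : ∀ r, μ (r + 1) = ∑ l ∈ Finset.range (r + 1), (r.choose l : R) * μ l * κ (r + 1 - l)) :
    HasLogDeriv (PowerSeries.mk fun j => μ j / (j ! : R)) (egfDeriv κ) := by
  refine ⟨by simp [← PowerSeries.coeff_zero_eq_constantCoeff_apply, h0], ?_⟩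
  rw [derivative_mk_div_factorial]
  ext r
  rw [PowerSeries.coeff_mul, Finset.Nat.sum_antidiagonal_eq_sum_range_succ_mk, egfDeriv,
    PowerSeries.coeff_mk, h, Finset.sum_div]
  refine Finset.sum_congr rfl fun l hl => ?_
  have hlr : l ≤ r := by simpa [Nat.lt_succ_iff] using hl
  rw [PowerSeries.coeff_mk, egfDeriv, PowerSeries.coeff_mk, Nat.cast_choose R hlr,
    Nat.sub_add_comm hlr]
  have h1 : (l ! : R) ≠ 0 := Nat.cast_ne_zero.2 l.factorial_ne_zero
  have h2 : (r ! : R) ≠ 0 := Nat.cast_ne_zero.2 r.factorial_ne_zero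
  have h3 : ((r - l)! : R) ≠ 0 := Nat.cast_ne_zero.2 (r - l).factorial_ne_zero
  field_simp

end PowerSeries

/-! ### The partition expansion of the Bell polynomials. -/

section Partitions

/-- `∏_{i} (i!)^{m_i} m_i!`, where `m_i` is the multiplicity of `i` in `s`. -/
def yMultiset (s : Multiset ℕ) : ℕ := ∏ i ∈ s.toFinset, i ! ^ s.count i * (s.count i)!

theorem yMultiset_eq_prod {s : Multiset ℕ} {T : Finset ℕ} (h : s.toFinset ⊆ T) :
    yMultiset s = ∏ i ∈ T, i ! ^ s.count i * (s.count i)! := by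
  refine Finset.prod_subset h fun i _ hi => ?_
  rw [Multiset.mem_toFinset, ← Multiset.count_eq_zero] at hi
  simp [hi]

theorem yMultiset_cons (i : ℕ) (s : Multiset ℕ) :
    yMultiset (i ::ₘ s) = i ! * (s.count i + 1) * yMultiset s := by
  have hi : i ∈ insert i s.toFinset := Finset.mem_insert_self _ _
  rw [yMultiset_eq_prod (T := insert i s.toFinset) (s := i ::ₘ s) (by simp),
    yMultiset_eq_prod (T := insert i s.toFinset) (s := s) (Finset.subset_insert _ _),
    ← Finset.mul_prod_erase _ _ hi, ← Finset.mul_prod_erase _ _ hi, Multiset.count_cons_self,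
    Finset.prod_congr rfl fun j hj => by rw [Multiset.count_cons_of_ne (Finset.ne_of_mem_erase hj)],
    Nat.factorial_succ, pow_succ]
  ring

theorem yMultiset_pos (s : Multiset ℕ) : 0 < yMultiset s :=
  Finset.prod_pos fun _ _ => by positivity

/-- The partition obtained by adjoining the part `i`. -/
def consPartition {m : ℕ} (i : ℕ) (hi : 0 < i) (π : Nat.Partition m) : Nat.Partition (i + m) where
  parts := i ::ₘ π.parts
  parts_pos h := by
    rcases Multiset.mem_cons.1 h with rfl | h
    exacts [hi, π.parts_pos h]
  parts_sum := by rw [Multiset.sum_cons, π.parts_sum]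

variable {R : Type*} [Field R]

/-- `x_π / y_π`, for a multiset `π`. -/
noncomputable def partWeight (x : ℕ → R) (s : Multiset ℕ) : R :=
  (s.map x).prod / (yMultiset s : R)

/-- Adjoining a part `i` multiplies `y` by `i!` and by the new multiplicity of `i`; the count on the
left cancels the latter. -/
theorem partWeight_cons [CharZero R] (x : ℕ → R) (i : ℕ) (s : Multiset ℕ) :
    ((i ::ₘ s).count i : R) * partWeight x (i ::ₘ s) = x i / (i ! : R) * partWeight x s := by
  have h1 : (i ! : R) ≠ 0 := Nat.cast_ne_zero.2 i.factorial_ne_zero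
  have h2 : (yMultiset s : R) ≠ 0 := Nat.cast_ne_zero.2 (yMultiset_pos s).ne'
  have h3 : (s.count i + 1 : R) ≠ 0 := Nat.cast_add_one_ne_zero _
  rw [partWeight, partWeight, yMultiset_cons, Multiset.count_cons_self, Multiset.map_cons,
    Multiset.prod_cons]
  push_cast
  field_simp

theorem sum_count_mul_partWeight [CharZero R] (x : ℕ → R) {i m : ℕ} (hi : 0 < i) :
    ∑ π : Nat.Partition (i + m), (π.parts.count i : R) * partWeight x π.parts =
      x i / (i ! : R) * ∑ π : Nat.Partition m, partWeight x π.parts := by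
  rw [Finset.mul_sum]
  symm
  -- Partitions without the part `i` contribute zero; each of the others arises once, by adjoining
  -- `i` to a partition of `m`.
  refine Finset.sum_bij_ne_zero (fun π _ _ => consPartition i hi π) (fun _ _ _ => Finset.mem_univ _)
    (fun π _ _ ρ _ _ h => ?_) (fun π _ h => ?_) (fun π _ _ => (partWeight_cons x i π.parts).symm)
  · have := congrArg Nat.Partition.parts h
    exact Nat.Partition.ext ((Multiset.cons_inj_right i).1 this)
  · have hc : i ∈ π.parts := by
      by_contra hc
      simp [Multiset.count_eq_zero_of_notMem hc] at h
    have he := Multiset.cons_erase hc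
    let ρ : Nat.Partition m := ⟨π.parts.erase i,
      fun hj => π.parts_pos (Multiset.mem_of_mem_erase hj),
      by have := π.parts_sum; rw [← he, Multiset.sum_cons] at this; omega⟩
    have hρ : consPartition i hi ρ = π := Nat.Partition.ext he
    refine ⟨ρ, Finset.mem_univ _, ?_, hρ⟩
    rw [← partWeight_cons, he]
    exact h

theorem hasLogDeriv_partition_series [CharZero R] (x : ℕ → R) :
    HasLogDeriv (PowerSeries.mk fun m => ∑ π : Nat.Partition m, partWeight x π.parts)
      (egfDeriv x) := by
  refine ⟨by simp [← PowerSeries.coeff_zero_eq_constantCoeff_apply, partWeight, yMultiset], ?_⟩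
  ext r
  rw [PowerSeries.coeff_derivative, PowerSeries.coeff_mk, mul_comm (PowerSeries.mk _),
    PowerSeries.coeff_mul, Finset.Nat.sum_antidiagonal_eq_sum_range_succ_mk, Finset.sum_mul]
  -- The identity `r + 1 = ∑ i m_i` turns the factor from differentiation into a sum over the part
  -- to be removed.
  have h1 : ∀ π : Nat.Partition (r + 1), ((r : R) + 1) =
      ∑ k ∈ Finset.range (r + 1), ((k + 1 : ℕ) : R) * (π.parts.count (k + 1) : R) := fun π => by
    have h := (Finset.sum_multiset_count_of_subset π.parts (Finset.range (r + 2)) fun i hi => by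
      have := Nat.Partition.le_of_mem_parts (Multiset.mem_toFinset.1 hi)
      simp only [Finset.mem_range]
      omega)
    rw [π.parts_sum, Finset.sum_range_succ'] at h
    simp only [smul_eq_mul, mul_zero, add_zero] at h
    have h' := congrArg (Nat.cast : ℕ → R) h
    push_cast at h' ⊢
    rw [h']
    exact Finset.sum_congr rfl fun k _ => mul_comm _ _
  rw [Finset.sum_congr rfl fun π _ => by rw [h1 π, Finset.mul_sum], Finset.sum_comm]
  refine Finset.sum_congr rfl fun k hk => ?_
  obtain ⟨m, rfl⟩ : ∃ m, r = k + m := Nat.exists_eq_add_of_le (by simpa [Nat.lt_succ_iff] using hk)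
  have key := sum_count_mul_partWeight x (i := k + 1) (m := m) k.succ_pos
  rw [show k + 1 + m = k + m + 1 by ring] at key
  rw [egfDeriv, PowerSeries.coeff_mk, PowerSeries.coeff_mk, Nat.add_sub_cancel_left]
  have h2 : (k ! : R) ≠ 0 := Nat.cast_ne_zero.2 k.factorial_ne_zero
  have h3 : (k + 1 : R) ≠ 0 := Nat.cast_add_one_ne_zero k
  have h4 : x (k + 1) / (k ! : R) = (k + 1) * (x (k + 1) / ((k + 1)! : R)) := by
    rw [Nat.factorial_succ]
    push_cast
    field_simp
  rw [h4, mul_assoc, ← key, Finset.mul_sum]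
  refine Finset.sum_congr rfl fun π _ => ?_
  push_cast
  ring

theorem bell_eq_sum_partitions [CharZero R] [Algebra ℚ R] (m : ℕ) (x : ℕ → R) :
    bell m x = (m ! : R) * ∑ π : Nat.Partition m, partWeight x π.parts := by
  rw [bell, (hasLogDeriv_exp_subst x).unique (hasLogDeriv_partition_series x),
    PowerSeries.coeff_mk]

end Partitions

/-! ### Products of exponential series. -/

section PowerSeries

theorem hasLogDeriv_mk_pow {R : Type*} [Field R] [CharZero R] (y : R) :
    HasLogDeriv (PowerSeries.mk fun j => y ^ j / (j ! : R)) (PowerSeries.C y) := by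
  refine ⟨by simp [← PowerSeries.coeff_zero_eq_constantCoeff_apply], ?_⟩
  rw [derivative_mk_div_factorial]
  ext j
  rw [egfDeriv, PowerSeries.coeff_mk, PowerSeries.coeff_mul_C, PowerSeries.coeff_mk]
  ring

/-- The multinomial theorem, in the form `∏ e^(y_i t) = e^((∑ y_i) t)`. -/
theorem coeff_prod_mk_pow {R : Type*} [Field R] [CharZero R] {ι : Type*} (s : Finset ι)
    (y : ι → R) (m : ℕ) :
    PowerSeries.coeff m (∏ i ∈ s, PowerSeries.mk fun j => y i ^ j / (j ! : R)) =
      (∑ i ∈ s, y i) ^ m / (m ! : R) := by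
  rw [(HasLogDeriv.prod s fun i _ => hasLogDeriv_mk_pow (y i)).unique
    (G := PowerSeries.mk fun j => (∑ i ∈ s, y i) ^ j / (j ! : R)), PowerSeries.coeff_mk]
  rw [← map_sum]
  exact hasLogDeriv_mk_pow _

end PowerSeries

/-! ### Moments of `⟨X, x⟩` through cumulants. -/

section Moments

variable {Ω : Type*} [MeasurableSpace Ω] {P : Measure Ω} {n : ℕ} {X : Fin n → Ω → ℝ}

theorem integrable_prod_comp [IsProbabilityMeasure P] (hmeas : ∀ i, Measurable (X i))
    (hindep : iIndepFun X P) {f : Fin n → ℝ → ℝ} (hf : ∀ i, Measurable (f i))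
    (hint : ∀ i, Integrable (fun ω => f i (X i ω)) P) :
    Integrable (fun ω => ∏ i, f i (X i ω)) P := by
  have hprob : ∀ i, IsProbabilityMeasure (P.map (X i)) := fun i =>
    Measure.isProbabilityMeasure_map (hmeas i).aemeasurable
  have h : Integrable (fun v : Fin n → ℝ => ∏ i, f i (v i)) (P.map fun ω i => X i ω) := by
    rw [hindep.map_fun_eq_pi_map fun i => (hmeas i).aemeasurable]
    exact Integrable.fintype_prod fun i =>
      (integrable_map_measure (hf i).aestronglyMeasurable (hmeas i).aemeasurable).2 (hint i)
  exact h.comp_measurable (measurable_pi_lambda _ hmeas)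

theorem integrable_pow_of_memLp [IsProbabilityMeasure P] {Y : Ω → ℝ} {m k : ℕ}
    (hY : MemLp Y m P) (hk : k ≤ m) : Integrable (fun ω => Y ω ^ k) P := by
  have h := (hY.mono_exponent (p := (k : ENNReal)) (by exact_mod_cast hk)).integrable_norm_pow'
  refine h.mono' (hY.aestronglyMeasurable.pow k) (.of_forall fun ω => ?_)
  simp

/-- Both sides expand over exponents `l` with sum `m`, and independence factors the expectation of
each term. Only moments of order at most `m` occur, and these are finite. -/
theorem integral_pairing_pow_eq_coeff [IsProbabilityMeasure P] {m : ℕ}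
    (hmeas : ∀ i, Measurable (X i)) (hX : ∀ i, MemLp (X i) m P) (hindep : iIndepFun X P)
    (x : Fin n → ℝ) :
    (∫ ω, pairing X x ω ^ m ∂P) / (m ! : ℝ) = PowerSeries.coeff m
      (∏ i, PowerSeries.mk fun j => x i ^ j * moment (X i) j P / (j ! : ℝ)) := by
  have hle : ∀ l ∈ (Finset.univ : Finset (Fin n)).finsuppAntidiag m, ∀ i, l i ≤ m := by
    intro l hl i
    rw [← (Finset.mem_finsuppAntidiag.1 hl).1]
    exact Finset.single_le_sum (fun _ _ => Nat.zero_le _) (Finset.mem_univ i)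
  have hfm : ∀ (l : Fin n →₀ ℕ) i, Measurable fun t : ℝ => (t * x i) ^ l i / ((l i)! : ℝ) := by
    intro l i
    fun_prop
  have hmom : ∀ (l : Fin n →₀ ℕ) i, ∫ ω, (X i ω * x i) ^ l i / ((l i)! : ℝ) ∂P =
      x i ^ l i * moment (X i) (l i) P / ((l i)! : ℝ) := fun l i => by
    rw [integral_div]
    simp_rw [mul_pow]
    rw [integral_mul_const, mul_comm]
    rfl
  rw [← integral_div, PowerSeries.coeff_prod]
  simp_rw [pairing, ← coeff_prod_mk_pow, PowerSeries.coeff_prod, PowerSeries.coeff_mk]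
  rw [integral_finsetSum]
  · refine Finset.sum_congr rfl fun l _ => ?_
    rw [hindep.integral_fun_prod_comp (f := fun i t => (t * x i) ^ l i / ((l i)! : ℝ))
      (fun i => (hmeas i).aemeasurable) fun i => (hfm l i).aestronglyMeasurable]
    exact Finset.prod_congr rfl fun i _ => hmom l i
  · intro l hl
    refine integrable_prod_comp hmeas hindep (hfm l) fun i => ?_
    simp_rw [mul_pow]
    exact ((integrable_pow_of_memLp (hX i) (hle l hl i)).mul_const _).div_const _

/-- No integrability is required: where a moment fails to exist it has the default value `0`, and
the recurrence holds by the definition of `cumulant`. Such terms never reach the coefficients in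
use. -/
theorem hasLogDeriv_moment_series [IsProbabilityMeasure P] (Y : Ω → ℝ) (a : ℝ) :
    HasLogDeriv (PowerSeries.mk fun j => a ^ j * moment Y j P / (j ! : ℝ))
      (egfDeriv fun j => a ^ j * cumulant P Y j) := by
  refine hasLogDeriv_of_recurrence (by simp [moment]) fun r => ?_
  rw [moment_eq_sum_cumulant P Y (r + 1) (by omega), Finset.mul_sum]
  refine Finset.sum_congr rfl fun l hl => ?_
  rw [show a ^ (r + 1) = a ^ l * a ^ (r + 1 - l) by
    rw [← pow_add]; congr 1; have := Finset.mem_range.1 hl; omega, Nat.add_sub_cancel]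
  ring

theorem moment_eq_of_identDistrib {Y Z : Ω → ℝ} (h : IdentDistrib Y Z P P) (j : ℕ) :
    moment Y j P = moment Z j P :=
  h.pow.integral_eq

theorem integral_pairing_pow_eq_sum_partitions [IsProbabilityMeasure P] {m : ℕ}
    (hmeas : ∀ i, Measurable (X i)) (hX : ∀ i, MemLp (X i) m P) (hindep : iIndepFun X P)
    {Y : Ω → ℝ} (hident : ∀ i, IdentDistrib (X i) Y P P) (x : Fin n → ℝ) :
    (∫ ω, pairing X x ω ^ m ∂P) / (m ! : ℝ) =
      ∑ π : Nat.Partition m, kappaPart (cumulant P Y) π * psumPart π x / (yPart π : ℝ) := by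
  rw [integral_pairing_pow_eq_coeff hmeas hX hindep]
  simp_rw [moment_eq_of_identDistrib (hident _)]
  have h := HasLogDeriv.prod Finset.univ fun i _ => hasLogDeriv_moment_series (P := P) Y (x i)
  rw [sum_egfDeriv] at h
  rw [h.unique (hasLogDeriv_partition_series _), PowerSeries.coeff_mk]
  refine Finset.sum_congr rfl fun π _ => ?_
  simp_rw [← Finset.sum_mul]
  rw [partWeight, Multiset.prod_map_mul, mul_comm]
  rfl

end Moments

/-! ### Even exponents. -/

section EvenPower

variable {Ω : Type*} [MeasurableSpace Ω] {P : Measure Ω} {n : ℕ} {X : Fin n → Ω → ℝ}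

theorem vecNorm_pow_eq {m : ℕ} (hm : Even m) (hm0 : m ≠ 0) (x : Fin n → ℝ) :
    vecNorm P X m x ^ m = (∫ ω, pairing X x ω ^ m ∂P) / (m ! : ℝ) := by
  have h0 : 0 ≤ (∫ ω, |pairing X x ω| ^ (m : ℝ) ∂P) / Real.Gamma (m + 1) :=
    div_nonneg (integral_nonneg fun ω => by positivity) (Real.Gamma_pos_of_pos (by positivity)).le
  rw [vecNorm, one_div, Real.rpow_inv_natCast_pow h0 hm0, Real.Gamma_nat_eq_factorial]
  simp_rw [Real.rpow_natCast, hm.pow_abs]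

end EvenPower

/-! ### The moment generating function of `⟨X, x⟩`. -/

section MomentGeneratingFunction

variable {Ω : Type*} [MeasurableSpace Ω] {P : Measure Ω} {n : ℕ} {X : Fin n → Ω → ℝ}

theorem pairing_eq_sum {Ω : Type*} {n : ℕ} (X : Fin n → Ω → ℝ) (x : Fin n → ℝ) :
    pairing X x = ∑ i, fun ω => X i ω * x i := by
  ext ω
  simp [pairing]

theorem iIndepFun_mul_const (hindep : iIndepFun X P) (x : Fin n → ℝ) :
    iIndepFun (fun i ω => X i ω * x i) P :=
  hindep.comp (fun i s => s * x i) fun i => measurable_mul_const (x i)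

theorem mgf_pairing (hmeas : ∀ i, Measurable (X i)) (hindep : iIndepFun X P) {Y : Ω → ℝ}
    (hident : ∀ i, IdentDistrib (X i) Y P P) (x : Fin n → ℝ) (t : ℝ) :
    mgf (pairing X x) P t = ∏ i, mgf Y P (x i * t) := by
  rw [pairing_eq_sum, (iIndepFun_mul_const hindep x).mgf_sum
    fun i => (hmeas i).mul_const (x i)]
  refine Finset.prod_congr rfl fun i _ => ?_
  rw [← mgf_congr_of_identDistrib (X i) Y (hident i)]
  simp only [mgf]
  congr 1
  ext ω
  congr 1
  ring

theorem zero_mem_interior_integrableExpSet_pairing [IsProbabilityMeasure P]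
    (hmeas : ∀ i, Measurable (X i)) (hindep : iIndepFun X P) {Y : Ω → ℝ}
    (hident : ∀ i, IdentDistrib (X i) Y P P) (hY : 0 ∈ interior (integrableExpSet Y P))
    (x : Fin n → ℝ) : 0 ∈ interior (integrableExpSet (pairing X x) P) := by
  rw [mem_interior_iff_mem_nhds] at hY ⊢
  have h : ∀ i, ∀ᶠ t in 𝓝 (0 : ℝ), x i * t ∈ integrableExpSet Y P := fun i => by
    have hc : Filter.Tendsto (fun t : ℝ => x i * t) (𝓝 0) (𝓝 0) := by
      have : Continuous fun t : ℝ => x i * t := by fun_prop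
      simpa using this.tendsto 0
    exact hc hY
  filter_upwards [Filter.eventually_all.2 h] with t ht
  rw [integrableExpSet, Set.mem_ofPred_eq, pairing_eq_sum]
  refine (iIndepFun_mul_const hindep x).integrable_exp_mul_sum
    (fun i => (hmeas i).mul_const (x i)) fun i _ => ?_
  have hu : Measurable fun s : ℝ => Real.exp (x i * t * s) := by fun_prop
  have := ((hident i).comp hu).integrable_iff.2 (ht i)
  refine this.congr (.of_forall fun ω => ?_)
  simp only [Function.comp_apply]
  congr 1
  ring

theorem hasPowerSeriesCoeff_mgf {Y : Ω → ℝ} (hY : 0 ∈ interior (integrableExpSet Y P)) (m : ℕ) :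
    HasPowerSeriesCoeff (mgf Y P) m ((∫ ω, Y ω ^ m ∂P) / (m ! : ℝ)) := by
  refine ⟨fun j => (∫ ω, Y ω ^ j ∂P) / (j ! : ℝ), ?_, rfl⟩
  filter_upwards [(hasFPowerSeriesAt_mgf hY).eventually_hasSum] with t ht
  simpa [FormalMultilinearSeries.ofScalars_apply_eq, mul_comm] using ht

end MomentGeneratingFunction

/-! ### The norm as a symmetric polynomial in the eigenvalues. -/

section SymmetricPolynomial

/-- The symmetric polynomial `∑_{π ⊢ m} κ_π p_π / y_π`. -/
noncomputable def normPolynomial (n : ℕ) (κ : ℕ → ℝ) (m : ℕ) : MvPolynomial (Fin n) ℝ :=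
  ∑ π : Nat.Partition m, MvPolynomial.C (kappaPart κ π / (yPart π : ℝ)) *
    (π.parts.map (MvPolynomial.psum (Fin n) ℝ)).prod

theorem eval_normPolynomial (n : ℕ) (κ : ℕ → ℝ) (m : ℕ) (x : Fin n → ℝ) :
    MvPolynomial.eval x (normPolynomial n κ m) =
      ∑ π : Nat.Partition m, kappaPart κ π * psumPart π x / (yPart π : ℝ) := by
  rw [normPolynomial, map_sum]
  refine Finset.sum_congr rfl fun π _ => ?_
  rw [map_mul, MvPolynomial.eval_C, map_multiset_prod, Multiset.map_map, psumPart,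
    div_mul_eq_mul_div]
  congr 4
  ext k
  simp [MvPolynomial.psum]

theorem normPolynomial_isSymmetric (n : ℕ) (κ : ℕ → ℝ) (m : ℕ) :
    (normPolynomial n κ m).IsSymmetric := by
  rw [← MvPolynomial.mem_symmetricSubalgebra]
  refine Subalgebra.sum_mem _ fun π _ => Subalgebra.mul_mem _ ?_ ?_
  · exact (MvPolynomial.mem_symmetricSubalgebra _).2 (MvPolynomial.IsSymmetric.C _)
  · refine Subalgebra.multiset_prod_mem _ fun p hp => ?_
    obtain ⟨k, -, rfl⟩ := Multiset.mem_map.1 hp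
    exact (MvPolynomial.mem_symmetricSubalgebra _).2 (MvPolynomial.psum_isSymmetric _ _ k)

theorem normPolynomial_isHomogeneous (n : ℕ) (κ : ℕ → ℝ) (m : ℕ) :
    (normPolynomial n κ m).IsHomogeneous m := by
  have h : ∀ s : Multiset ℕ,
      ((s.map (MvPolynomial.psum (Fin n) ℝ)).prod).IsHomogeneous s.sum := fun s => by
    induction s using Multiset.induction_on with
    | empty => simpa using MvPolynomial.isHomogeneous_one (Fin n) ℝ
    | cons k s ih =>
      rw [Multiset.map_cons, Multiset.prod_cons, Multiset.sum_cons]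
      refine MvPolynomial.IsHomogeneous.mul ?_ ih
      exact MvPolynomial.IsHomogeneous.sum _ _ _ fun i _ => MvPolynomial.isHomogeneous_X_pow i k
  refine MvPolynomial.IsHomogeneous.sum _ _ _ fun π _ => ?_
  have := h π.parts
  rw [π.parts_sum] at this
  exact this.C_mul _

end SymmetricPolynomial

/-! ### Power sums of eigenvalues as traces. -/

section TracePowers

variable {n : ℕ}

theorem sum_eig_pow (A : Herm n) (k : ℕ) :
    ((∑ i, eig A i ^ k : ℝ) : ℂ) = ((A : Matrix (Fin n) (Fin n) ℂ) ^ k).trace := by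
  obtain ⟨σ, hσ⟩ := exists_eig_eq_eigenvalues_comp A
  have h1 : ∑ i, eig A i ^ k = ∑ i, A.isHermitian.eigenvalues i ^ k := by
    rw [hσ]
    exact Equiv.sum_comp σ fun i => A.isHermitian.eigenvalues i ^ k
  rw [h1]
  conv_rhs => rw [A.isHermitian.spectral_theorem, ← map_pow, Unitary.conjStarAlgAut_apply,
    Matrix.trace_mul_cycle, Unitary.coe_star_mul_self, one_mul, Matrix.diagonal_pow,
    Matrix.trace_diagonal]
  simp

theorem psumPart_eig {m : ℕ} (π : Nat.Partition m) (A : Herm n) :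
    (psumPart π (eig A) : ℂ) =
      (π.parts.map fun k => ((A : Matrix (Fin n) (Fin n) ℂ) ^ k).trace).prod := by
  rw [psumPart, ← Complex.ofRealHom_eq_coe, map_multiset_prod, Multiset.map_map]
  congr 2
  ext k
  exact sum_eig_pow A k

theorem bell_traces_eq (κ : ℕ → ℝ) (m : ℕ) (A : Herm n) :
    1 / (m ! : ℂ) * bell m (fun j => (κ j : ℂ) * ((A : Matrix (Fin n) (Fin n) ℂ) ^ j).trace) =
      ((∑ π : Nat.Partition m, kappaPart κ π * psumPart π (eig A) / (yPart π : ℝ) : ℝ) : ℂ) := by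
  have hm : (m ! : ℂ) ≠ 0 := Nat.cast_ne_zero.2 m.factorial_ne_zero
  rw [bell_eq_sum_partitions, ← mul_assoc, one_div, inv_mul_cancel₀ hm, one_mul]
  push_cast
  refine Finset.sum_congr rfl fun π _ => ?_
  rw [partWeight, Multiset.prod_map_mul, psumPart_eig, kappaPart, ← Complex.ofRealHom_eq_coe,
    map_multiset_prod, Multiset.map_map]
  rfl

end TracePowers

/-! ### Products of traces of blocks, as multilinear maps. -/

section BlockTrace

variable {n : ℕ}

/-- `(tr w₁)(tr w₂) ⋯`, where `w` is cut into consecutive blocks `w₁, w₂, …` of given lengths. -/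
noncomputable def blockTrace (ls : List ℕ) (w : List (Matrix (Fin n) (Fin n) ℂ)) : ℂ :=
  ((ls.splitLengths w).map fun u => u.prod.trace).prod

theorem blockTrace_cons (l : ℕ) (ls : List ℕ) (w : List (Matrix (Fin n) (Fin n) ℂ)) :
    blockTrace (l :: ls) w = (w.take l).prod.trace * blockTrace ls (w.drop l) := by
  simp [blockTrace, List.splitLengths_cons]

/-- Exactly one block contains the varying letter, and its trace is linear in it. The strict bound
keeps that letter from falling beyond the last block, where it would be discarded. -/
theorem exists_linearMap_blockTrace (ls : List ℕ) (w₁ w₂ : List (Matrix (Fin n) (Fin n) ℂ))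
    (h : w₁.length < ls.sum) : ∃ L : Matrix (Fin n) (Fin n) ℂ →ₗ[ℂ] ℂ,
      ∀ Z, blockTrace ls (w₁ ++ Z :: w₂) = L Z := by
  induction ls generalizing w₁ with
  | nil => simp at h
  | cons l ls ih =>
    rcases lt_or_ge w₁.length l with hl | hl
    · obtain ⟨k, rfl⟩ : ∃ k, l = w₁.length + (k + 1) := ⟨l - w₁.length - 1, by omega⟩
      refine ⟨blockTrace ls (w₂.drop k) • (Matrix.traceLinearMap (Fin n) ℂ ℂ ∘ₗ
        LinearMap.mulLeft ℂ w₁.prod ∘ₗ LinearMap.mulRight ℂ (w₂.take k).prod), fun Z => ?_⟩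
      rw [blockTrace_cons, List.take_length_add_append, List.drop_length_add_append,
        List.take_succ_cons, List.drop_succ_cons, List.prod_append, List.prod_cons]
      simp [mul_comm]
    · obtain ⟨L, hL⟩ := ih (w₁.drop l) (by
        simp only [List.sum_cons, List.length_drop] at h ⊢
        omega)
      refine ⟨(w₁.take l).prod.trace • L, fun Z => ?_⟩
      rw [blockTrace_cons, List.take_append_of_le_length hl, List.drop_append_of_le_length hl, hL]
      rfl

theorem ofFn_update_eq_append {α : Type*} {d : ℕ} (v : Fin d → α) (i : Fin d) (z : α) :
    List.ofFn (Function.update v i z) =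
      (List.ofFn v).take i ++ z :: (List.ofFn v).drop (i + 1) := by
  have h : List.ofFn (Function.update v i z) = (List.ofFn v).set i z :=
    List.ext_getElem (by simp) fun k _ _ => by
      simp [List.getElem_set, Function.update_apply, Fin.ext_iff, eq_comm]
  rw [h, List.set_eq_take_append_cons_drop, if_pos (by simp)]

/-- `blockTrace`, as a multilinear map. -/
noncomputable def blockTraceMultilinear {d : ℕ} (ls : List ℕ) (h : ls.sum = d) :
    MultilinearMap ℂ (fun _ : Fin d => Matrix (Fin n) (Fin n) ℂ) ℂ :=
  MultilinearMap.mk' (fun v => blockTrace ls (List.ofFn v))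
    (fun v i x y => by
      obtain ⟨L, hL⟩ := exists_linearMap_blockTrace ls ((List.ofFn v).take i)
        ((List.ofFn v).drop (i + 1)) (by simp [h])
      simp only [ofFn_update_eq_append, hL, map_add])
    (fun v i c x => by
      obtain ⟨L, hL⟩ := exists_linearMap_blockTrace ls ((List.ofFn v).take i)
        ((List.ofFn v).drop (i + 1)) (by simp [h])
      simp only [ofFn_update_eq_append, hL, map_smul])

theorem blockTrace_replicate (ls : List ℕ) (B : Matrix (Fin n) (Fin n) ℂ) :
    blockTrace ls (List.replicate ls.sum B) = (ls.map fun l => (B ^ l).trace).prod := by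
  induction ls with
  | nil => simp [blockTrace]
  | cons l ls ih =>
    rw [blockTrace_cons, List.sum_cons, List.take_replicate, List.drop_replicate,
      Nat.add_sub_cancel_left, ih, Nat.min_eq_left (Nat.le_add_right _ _), List.prod_replicate,
      List.map_cons, List.prod_cons]

variable {d : ℕ}

/-- The word of length `d` in `Z` and `Zᴴ`, with `Zᴴ` in the places in `S`. -/
def adjointWord (Z : Matrix (Fin n) (Fin n) ℂ) (S : Finset (Fin d)) :
    Fin d → Matrix (Fin n) (Fin n) ℂ := fun i => if i ∈ S then Zᴴ else Z

theorem prod_ite_mem_const (S : Finset (Fin d)) (a b : ℂ) :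
    ∏ i, (if i ∈ S then b else a) = b ^ S.card * a ^ (d - S.card) := by
  rw [Finset.prod_ite, Finset.prod_const, Finset.prod_const, Finset.filter_mem_eq_inter,
    Finset.univ_inter, Finset.filter_not, Finset.filter_mem_eq_inter, Finset.univ_inter,
    ← Finset.compl_eq_univ_sdiff, Finset.card_compl, Fintype.card_fin]

theorem sum_sort_parts (π : Nat.Partition d) : (π.parts.sort (· ≥ ·)).sum = d := by
  rw [← Multiset.sum_coe, Multiset.sort_eq, π.parts_sum]

theorem prod_map_sort_parts (π : Nat.Partition d) (f : ℕ → ℂ) :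
    ((π.parts.sort (· ≥ ·)).map f).prod = (π.parts.map f).prod := by
  rw [← Multiset.prod_coe, ← Multiset.map_coe, Multiset.sort_eq]

theorem tracePart_eq (π : Nat.Partition d) (Z : Matrix (Fin n) (Fin n) ℂ) :
    tracePart π Z = (∑ S ∈ Finset.powersetCard (d / 2) (Finset.univ : Finset (Fin d)),
      blockTraceMultilinear _ (sum_sort_parts π) (adjointWord Z S)) / (d.choose (d / 2) : ℂ) :=
  rfl

theorem blockTraceMultilinear_const (π : Nat.Partition d) (B : Matrix (Fin n) (Fin n) ℂ) :
    blockTraceMultilinear _ (sum_sort_parts π) (fun _ : Fin d => B) =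
      (π.parts.map fun l => (B ^ l).trace).prod := by
  change blockTrace _ (List.ofFn fun _ : Fin d => B) = _
  rw [List.ofFn_const, ← prod_map_sort_parts, ← blockTrace_replicate, sum_sort_parts]

/-- A noncommutative binomial expansion: multilinearity sorts the words by the set `S` of places
with an adjoint. -/
theorem prod_trace_pow_eq_sum (π : Nat.Partition d) (Z : Matrix (Fin n) (Fin n) ℂ) (a b : ℂ) :
    (π.parts.map fun l => ((a • Z + b • Zᴴ) ^ l).trace).prod =
      ∑ S : Finset (Fin d), b ^ S.card * a ^ (d - S.card) *
        blockTraceMultilinear _ (sum_sort_parts π) (adjointWord Z S) := by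
  rw [← blockTraceMultilinear_const, add_comm (a • Z)]
  have h := (blockTraceMultilinear _ (sum_sort_parts π)).map_add_univ
    (fun _ : Fin d => b • Zᴴ) (fun _ => a • Z)
  refine h.trans (Finset.sum_congr rfl fun S _ => ?_)
  rw [← prod_ite_mem_const, ← smul_eq_mul, ← MultilinearMap.map_smul_univ]
  congr 1
  ext i : 1
  by_cases hi : i ∈ S <;> simp [adjointWord, hi]

/-- Each word has as many adjoints as plain letters, so the scalars collect to `(c c̄)^(d/2) =
|c|^d`. -/
theorem tracePart_smul (hd : Even d) (π : Nat.Partition d) (c : ℂ)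
    (Z : Matrix (Fin n) (Fin n) ℂ) : tracePart π (c • Z) = (‖c‖ ^ d : ℝ) * tracePart π Z := by
  rw [tracePart_eq, tracePart_eq, ← mul_div_assoc, Finset.mul_sum]
  congr 1
  refine Finset.sum_congr rfl fun S hS => ?_
  obtain ⟨e, rfl⟩ := hd
  have hc : S.card = e := by rw [(Finset.mem_powersetCard.1 hS).2]; omega
  have h : adjointWord (c • Z) S =
      fun i => (if i ∈ S then star c else c) • adjointWord Z S i := by
    ext i : 1
    by_cases hi : i ∈ S <;> simp [adjointWord, hi]
  rw [h, MultilinearMap.map_smul_univ, prod_ite_mem_const, hc, Nat.add_sub_cancel, ← mul_pow,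
    smul_eq_mul, mul_comm (star c), Complex.star_def, Complex.mul_conj, Complex.normSq_eq_norm_sq,
    ← Complex.ofReal_pow, ← pow_mul, two_mul]

end BlockTrace

/-! ### Averaging over roots of unity. -/

section RootsOfUnity

/-- The exponent `d - 2s` has absolute value at most `d`, so it is divisible by the order `d + 1`
only when it is zero. Otherwise the geometric sum vanishes. -/
theorem sum_root_of_unity_pow {d : ℕ} {ω : ℂ} (hω : IsPrimitiveRoot ω (d + 1)) {s : ℕ}
    (hs : s ≤ d) : ∑ k ∈ Finset.range (d + 1), ((ω ^ k)⁻¹) ^ s * (ω ^ k) ^ (d - s) =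
      if 2 * s = d then (d + 1 : ℂ) else 0 := by
  have hω0 : ω ≠ 0 := hω.ne_zero (by omega)
  have h1 : ∀ k, ((ω ^ k)⁻¹) ^ s * (ω ^ k) ^ (d - s) = (ω ^ ((d : ℤ) - 2 * s)) ^ k := fun k => by
    rw [← zpow_natCast ω k, ← zpow_neg, ← zpow_natCast, ← zpow_natCast, ← zpow_natCast,
      ← zpow_mul, ← zpow_mul, ← zpow_mul, ← zpow_add₀ hω0]
    congr 1
    push_cast [hs]
    ring
  simp_rw [h1]
  split_ifs with h
  · have : (d : ℤ) - 2 * s = 0 := by omega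
    simp [this]
  · have hne : ω ^ ((d : ℤ) - 2 * s) ≠ 1 := fun h2 => by
      rw [hω.zpow_eq_one_iff_dvd] at h2
      have := Int.eq_zero_of_abs_lt_dvd h2 (by rw [abs_lt]; push_cast; omega)
      omega
    have h3 : (ω ^ ((d : ℤ) - 2 * s)) ^ (d + 1) = 1 := by
      rw [← zpow_natCast, ← zpow_mul, mul_comm, zpow_mul, zpow_natCast, hω.pow_eq_one, one_zpow]
    rw [geom_sum_eq hne, h3, sub_self, zero_div]

variable {n d : ℕ}

theorem sum_prod_trace_pow_eq_tracePart (hd : Even d) {ω : ℂ} (hω : IsPrimitiveRoot ω (d + 1))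
    (π : Nat.Partition d) (Z : Matrix (Fin n) (Fin n) ℂ) :
    ∑ k ∈ Finset.range (d + 1),
      (π.parts.map fun l => ((ω ^ k • Z + (ω ^ k)⁻¹ • Zᴴ) ^ l).trace).prod =
        ((d + 1) * d.choose (d / 2) : ℝ) * tracePart π Z := by
  have hc : (d.choose (d / 2) : ℂ) ≠ 0 :=
    Nat.cast_ne_zero.2 (Nat.choose_pos (Nat.div_le_self d 2)).ne'
  simp_rw [prod_trace_pow_eq_sum]
  rw [Finset.sum_comm, tracePart_eq]
  push_cast
  rw [mul_assoc, mul_div_cancel₀ _ hc, Finset.mul_sum]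
  simp_rw [← Finset.sum_mul]
  rw [Finset.sum_congr rfl fun S _ => by
    rw [sum_root_of_unity_pow hω ((Finset.card_le_univ S).trans_eq (Fintype.card_fin d)), ite_mul,
      zero_mul], ← Finset.sum_filter]
  refine Finset.sum_congr ?_ fun _ _ => rfl
  ext S
  obtain ⟨e, rfl⟩ := hd
  simp only [Finset.mem_filter, Finset.mem_univ, true_and, Finset.mem_powersetCard_univ]
  omega

/-- The Hermitian matrix `u Z + ū Zᴴ`. -/
def twist (u : ℂ) (Z : Matrix (Fin n) (Fin n) ℂ) : Herm n :=
  ⟨u • Z + star u • Zᴴ, by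
    rw [selfAdjoint.mem_iff, Matrix.star_eq_conjTranspose]
    simp [add_comm]⟩

theorem twist_add (u : ℂ) (Z W : Matrix (Fin n) (Fin n) ℂ) :
    twist u (Z + W) = twist u Z + twist u W := by
  ext1
  simp only [twist, AddSubgroup.coe_add, Matrix.conjTranspose_add, smul_add]
  abel

theorem eq_zero_of_twist_eq_zero {u : ℂ} (hu : u.im ≠ 0) {Z : Matrix (Fin n) (Fin n) ℂ}
    (h1 : twist 1 Z = 0) (h2 : twist u Z = 0) : Z = 0 := by
  have h1' : Z + Zᴴ = 0 := by simpa [twist] using congrArg Subtype.val h1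
  have h2' : u • Z + star u • Zᴴ = 0 := by simpa [twist] using congrArg Subtype.val h2
  have h3 : (u - star u) • Z = 0 := by
    rw [eq_neg_of_add_eq_zero_right h1', smul_neg] at h2'
    rw [sub_smul, sub_eq_add_neg, h2']
  refine (smul_eq_zero.1 h3).resolve_left fun h4 => hu ?_
  have := congrArg Complex.im h4
  simp only [Complex.sub_im, Complex.star_def, Complex.conj_im, Complex.zero_im] at this
  linarith

/-- This writes `T_π` through spectra of Hermitian matrices, which shows that it is real and lets
the Hermitian norm act on it. -/
theorem tracePart_eq_average (hd : Even d) {ω : ℂ} (hω : IsPrimitiveRoot ω (d + 1))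
    (π : Nat.Partition d) (Z : Matrix (Fin n) (Fin n) ℂ) :
    tracePart π Z = (((∑ k ∈ Finset.range (d + 1), psumPart π (eig (twist (ω ^ k) Z))) /
      ((d + 1) * d.choose (d / 2)) : ℝ) : ℂ) := by
  have hc : (d.choose (d / 2) : ℝ) ≠ 0 :=
    Nat.cast_ne_zero.2 (Nat.choose_pos (Nat.div_le_self d 2)).ne'
  have hN : (((d + 1) * d.choose (d / 2) : ℝ) : ℂ) ≠ 0 :=
    Complex.ofReal_ne_zero.2 (mul_ne_zero (Nat.cast_add_one_ne_zero d) hc)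
  have hstar : ∀ k, star (ω ^ k) = (ω ^ k)⁻¹ := fun k => by
    rw [Complex.inv_eq_conj (by rw [norm_pow, hω.norm'_eq_one (by omega), one_pow])]
    rfl
  rw [Complex.ofReal_div, eq_div_iff hN, mul_comm, ← sum_prod_trace_pow_eq_tracePart hd hω,
    Complex.ofReal_sum]
  refine Finset.sum_congr rfl fun k _ => ?_
  rw [psumPart_eig]
  simp only [twist, hstar]

theorem tracePart_im (hd : Even d) (π : Nat.Partition d) (Z : Matrix (Fin n) (Fin n) ℂ) :
    (tracePart π Z).im = 0 := by
  rw [tracePart_eq_average hd (Complex.isPrimitiveRoot_exp (d + 1) (by omega)), Complex.ofReal_im]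

theorem ofReal_re_tracePart (hd : Even d) (π : Nat.Partition d)
    (Z : Matrix (Fin n) (Fin n) ℂ) : ((tracePart π Z).re : ℂ) = tracePart π Z :=
  Complex.ext (by simp) (by simp [tracePart_im hd])

theorem continuous_tracePart_re (hd : Even d) (π : Nat.Partition d) :
    Continuous fun Z : Matrix (Fin n) (Fin n) ℂ => (tracePart π Z).re := by
  have hω := Complex.isPrimitiveRoot_exp (d + 1) (by omega)
  set ω := Complex.exp (2 * Real.pi * Complex.I / (d + 1 : ℕ))
  have hc : (d.choose (d / 2) : ℝ) ≠ 0 :=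
    Nat.cast_ne_zero.2 (Nat.choose_pos (Nat.div_le_self d 2)).ne'
  have hN : (((d + 1) * d.choose (d / 2) : ℝ) : ℂ) ≠ 0 :=
    Complex.ofReal_ne_zero.2 (mul_ne_zero (Nat.cast_add_one_ne_zero d) hc)
  -- Continuity is read off traces of matrix powers, which avoids the continuity of eigenvalues.
  have h : ∀ Z : Matrix (Fin n) (Fin n) ℂ, tracePart π Z = (∑ k ∈ Finset.range (d + 1),
      (π.parts.map fun l => ((ω ^ k • Z + (ω ^ k)⁻¹ • Zᴴ) ^ l).trace).prod) /
        (((d + 1) * d.choose (d / 2) : ℝ) : ℂ) := fun Z => by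
    rw [sum_prod_trace_pow_eq_tracePart hd hω, mul_div_cancel_left₀ _ hN]
  simp_rw [h]
  refine Complex.continuous_re.comp (Continuous.div_const ?_ _)
  refine continuous_finsetSum _ fun k _ => continuous_multiset_prod _ fun l _ => ?_
  fun_prop

theorem tracePart_hermitian (π : Nat.Partition d) (A : Herm n) :
    tracePart π (A : Matrix (Fin n) (Fin n) ℂ) = psumPart π (eig A) := by
  have hc : (d.choose (d / 2) : ℂ) ≠ 0 :=
    Nat.cast_ne_zero.2 (Nat.choose_pos (Nat.div_le_self d 2)).ne'
  have hw : ∀ S : Finset (Fin d), adjointWord (A : Matrix (Fin n) (Fin n) ℂ) S =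
      fun _ => (A : Matrix (Fin n) (Fin n) ℂ) :=
    fun S => by
      ext i : 1
      by_cases hi : i ∈ S <;> simp [adjointWord, hi, A.isHermitian.eq]
  rw [tracePart_eq]
  simp_rw [hw, blockTraceMultilinear_const, ← psumPart_eig]
  rw [Finset.sum_const, Finset.card_powersetCard, Finset.card_univ, Fintype.card_fin,
    nsmul_eq_mul, mul_div_cancel_left₀ _ hc]

end RootsOfUnity

/-! ### Polynomials in traces of words. -/

section TracePolynomial

variable {n d : ℕ}

theorem evalWord_prod (Z : Matrix (Fin n) (Fin n) ℂ) (w : List (FreeMonoid Bool)) :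
    evalWord Z w.prod = (w.map (evalWord Z)).prod :=
  map_list_prod _ _

theorem map_splitLengths {α β : Type*} (f : α → β) (sz : List ℕ) (w : List α) :
    sz.splitLengths (w.map f) = (sz.splitLengths w).map (List.map f) := by
  induction sz generalizing w with
  | nil => rfl
  | cons l sz ih => simp [List.splitLengths_cons, ← List.map_take, ← List.map_drop, ih]

/-- The polynomial in traces of words with value `T_π(Z)` at `Z`. -/
noncomputable def tracePartPolynomial (π : Nat.Partition d) : MvPolynomial (FreeMonoid Bool) ℝ :=
  MvPolynomial.C ((d.choose (d / 2) : ℝ)⁻¹) *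
    ∑ S ∈ Finset.powersetCard (d / 2) (Finset.univ : Finset (Fin d)),
      (((π.parts.sort (· ≥ ·)).splitLengths
        (List.ofFn fun i : Fin d => FreeMonoid.of (decide (i ∉ S)))).map
          fun w => MvPolynomial.X w.prod).prod

theorem aeval_tracePartPolynomial (π : Nat.Partition d) (Z : Matrix (Fin n) (Fin n) ℂ) :
    MvPolynomial.aeval (fun w => (evalWord Z w).trace) (tracePartPolynomial π) =
      tracePart π Z := by
  rw [tracePartPolynomial, map_mul, MvPolynomial.aeval_C, map_sum, tracePart, div_eq_mul_inv,
    mul_comm]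
  congr 1
  · refine Finset.sum_congr rfl fun S _ => ?_
    have hw : (List.ofFn fun i : Fin d => if i ∈ S then Zᴴ else Z) =
        (List.ofFn fun i : Fin d => FreeMonoid.of (decide (i ∉ S))).map (evalWord Z) := by
      rw [List.map_ofFn]
      congr 1
      ext i : 1
      by_cases hi : i ∈ S <;> simp [evalWord, hi]
    rw [hw, map_splitLengths, map_list_prod, List.map_map, List.map_map]
    congr 2
    ext w
    simp [evalWord_prod]
  · simp

theorem isTracePolynomial_sum_tracePart (hd : Even d) (c : Nat.Partition d → ℝ) :
    IsTracePolynomial fun Z : Matrix (Fin n) (Fin n) ℂ => ∑ π, c π * (tracePart π Z).re := by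
  refine ⟨∑ π, MvPolynomial.C (c π) * tracePartPolynomial π, fun Z => ?_⟩
  rw [map_sum, Complex.ofReal_sum]
  refine Finset.sum_congr rfl fun π _ => ?_
  rw [map_mul, MvPolynomial.aeval_C, aeval_tracePartPolynomial, Complex.ofReal_mul,
    ofReal_re_tracePart hd]
  rfl

end TracePolynomial

/-! ### The norm on all complex matrices, built from a Hermitian norm `h` whose `d`th power is the
partition sum. -/

section MatrixNorm

variable {n d : ℕ} {h : Herm n → ℝ} {κ : ℕ → ℝ}

/-- A real number of modulus one squares to `1`, whereas `ω` has order `d + 1 ≥ 3`. -/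
theorem im_ne_zero_of_isPrimitiveRoot {ω : ℂ} (hω : IsPrimitiveRoot ω (d + 1)) (hd : 2 ≤ d) :
    ω.im ≠ 0 := fun h0 => by
  have h1 := Complex.normSq_eq_norm_sq ω
  rw [hω.norm'_eq_one (by omega), Complex.normSq_apply, h0] at h1
  have h2 : ω ^ 2 = 1 := by
    rw [sq]
    apply Complex.ext
    · simp only [Complex.mul_re, h0, Complex.one_re]
      linarith
    · simp [h0]
  have := Nat.le_of_dvd two_pos ((hω.pow_eq_one_iff_dvd 2).1 h2)
  omega

theorem sum_kappaPart_tracePart_eq (hd : Even d) {ω : ℂ} (hω : IsPrimitiveRoot ω (d + 1))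
    (hh : ∀ A, h A ^ d =
      ∑ π : Nat.Partition d, kappaPart κ π * psumPart π (eig A) / (yPart π : ℝ))
    (Z : Matrix (Fin n) (Fin n) ℂ) :
    ∑ π : Nat.Partition d, kappaPart κ π * (tracePart π Z).re / (yPart π : ℝ) =
      (∑ k ∈ Finset.range (d + 1), h (twist (ω ^ k) Z) ^ d) / ((d + 1) * d.choose (d / 2)) := by
  simp_rw [hh, tracePart_eq_average hd hω, Complex.ofReal_re]
  rw [Finset.sum_comm, Finset.sum_div]
  refine Finset.sum_congr rfl fun π _ => ?_
  rw [← mul_div_assoc, Finset.mul_sum, Finset.sum_div, Finset.sum_div, Finset.sum_div]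
  exact Finset.sum_congr rfl fun k _ => by ring

theorem sum_kappaPart_tracePart_nonneg (hN : IsNorm ℝ h) (hd : Even d)
    (hh : ∀ A, h A ^ d =
      ∑ π : Nat.Partition d, kappaPart κ π * psumPart π (eig A) / (yPart π : ℝ))
    (Z : Matrix (Fin n) (Fin n) ℂ) :
    0 ≤ ∑ π : Nat.Partition d, kappaPart κ π * (tracePart π Z).re / (yPart π : ℝ) := by
  rw [sum_kappaPart_tracePart_eq hd (Complex.isPrimitiveRoot_exp (d + 1) (by omega)) hh]
  exact div_nonneg (Finset.sum_nonneg fun k _ => pow_nonneg (hN.nonneg _) _) (by positivity)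

theorem matNorm_pow (hN : IsNorm ℝ h) (hd : Even d) (hd2 : 2 ≤ d)
    (hh : ∀ A, h A ^ d =
      ∑ π : Nat.Partition d, kappaPart κ π * psumPart π (eig A) / (yPart π : ℝ))
    (Z : Matrix (Fin n) (Fin n) ℂ) : matNorm κ d Z ^ d =
      ∑ π : Nat.Partition d, kappaPart κ π * (tracePart π Z).re / (yPart π : ℝ) := by
  rw [matNorm, one_div,
    Real.rpow_inv_natCast_pow (sum_kappaPart_tracePart_nonneg hN hd hh Z) (by omega)]

theorem matNorm_hermitian (hN : IsNorm ℝ h) (hd2 : 2 ≤ d)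
    (hh : ∀ A, h A ^ d =
      ∑ π : Nat.Partition d, kappaPart κ π * psumPart π (eig A) / (yPart π : ℝ))
    (A : Herm n) : matNorm κ d (A : Matrix (Fin n) (Fin n) ℂ) = h A := by
  simp_rw [matNorm, tracePart_hermitian, Complex.ofReal_re]
  rw [← hh, one_div, Real.pow_rpow_inv_natCast (hN.nonneg A) (by omega)]

theorem isNorm_matNorm (hN : IsNorm ℝ h) (hd : Even d) (hd2 : 2 ≤ d)
    (hh : ∀ A, h A ^ d =
      ∑ π : Nat.Partition d, kappaPart κ π * psumPart π (eig A) / (yPart π : ℝ)) :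
    IsNorm ℂ fun Z : Matrix (Fin n) (Fin n) ℂ => matNorm κ d Z := by
  have hω := Complex.isPrimitiveRoot_exp (d + 1) (by omega)
  set ω := Complex.exp (2 * Real.pi * Complex.I / (d + 1 : ℕ))
  have hsum := sum_kappaPart_tracePart_nonneg hN hd hh
  have hpos : (0 : ℝ) < (d + 1) * d.choose (d / 2) := by
    have := Nat.choose_pos (Nat.div_le_self d 2)
    positivity
  -- An `ℓ^d` norm of the vector of the numbers `h (twist (ω^k) Z)`, up to a constant; the absolute
  -- values match the form of `Real.Lp_add_le`.
  have heq : ∀ Z : Matrix (Fin n) (Fin n) ℂ, matNorm κ d Z =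
      (∑ k ∈ Finset.range (d + 1), |h (twist (ω ^ k) Z)| ^ (d : ℝ)) ^ (1 / (d : ℝ)) /
        ((d + 1) * d.choose (d / 2) : ℝ) ^ (1 / (d : ℝ)) := fun Z => by
    rw [matNorm, sum_kappaPart_tracePart_eq hd hω hh, Real.div_rpow _ hpos.le]
    · simp_rw [Real.rpow_natCast, hd.pow_abs]
    · exact Finset.sum_nonneg fun k _ => pow_nonneg (hN.nonneg _) _
  have hd0 : (1 / (d : ℝ)) ≠ 0 := by
    have : (d : ℝ) ≠ 0 := Nat.cast_ne_zero.2 (by omega)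
    positivity
  refine ⟨fun Z => Real.rpow_nonneg (hsum Z) _, fun Z => ⟨fun h0 => ?_, ?_⟩, fun c Z => ?_,
    fun Z W => ?_⟩
  · rw [matNorm, Real.rpow_eq_zero (hsum Z) hd0, sum_kappaPart_tracePart_eq hd hω hh,
      div_eq_zero_iff, or_iff_left hpos.ne',
      Finset.sum_eq_zero_iff_of_nonneg fun k _ => pow_nonneg (hN.nonneg _) _] at h0
    have h1 : ∀ k < d + 1, twist (ω ^ k) Z = 0 := fun k hk =>
      (hN.eq_zero_iff _).1 (pow_eq_zero_iff (by omega) |>.1 (h0 k (Finset.mem_range.2 hk)))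
    -- Two twists suffice, by `1` and by the nonreal `ω`: the first gives `Zᴴ = -Z`, the second then
    -- `(ω - ω̄) Z = 0`.
    exact eq_zero_of_twist_eq_zero (im_ne_zero_of_isPrimitiveRoot hω hd2)
      (by simpa using h1 0 (by omega)) (by simpa using h1 1 (by omega))
  · rintro rfl
    have := matNorm_hermitian hN hd2 hh 0
    rwa [(hN.eq_zero_iff 0).2 rfl] at this
  · have : ∑ π : Nat.Partition d, kappaPart κ π * (tracePart π (c • Z)).re / (yPart π : ℝ) =
        ‖c‖ ^ d * ∑ π : Nat.Partition d, kappaPart κ π * (tracePart π Z).re / (yPart π : ℝ) := by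
      rw [Finset.mul_sum]
      refine Finset.sum_congr rfl fun π _ => ?_
      rw [tracePart_smul hd, Complex.re_ofReal_mul]
      ring
    rw [matNorm, matNorm, this, Real.mul_rpow (by positivity) (hsum Z), one_div,
      Real.pow_rpow_inv_natCast (norm_nonneg c) (by omega)]
  · rw [heq, heq, heq, ← add_div]
    refine div_le_div_of_nonneg_right ?_ (by positivity)
    refine le_trans ?_ (Real.Lp_add_le _ _ _ (by exact_mod_cast (by omega : 1 ≤ d)))
    gcongr with k _
    · exact hN.nonneg _
    · rw [twist_add]
      exact hN.add_le _ _

theorem isPositiveDefinite_matNorm_pow (hN : IsNorm ℝ h) (hd : Even d) (hd2 : 2 ≤ d)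
    (hh : ∀ A, h A ^ d =
      ∑ π : Nat.Partition d, kappaPart κ π * psumPart π (eig A) / (yPart π : ℝ)) :
    IsPositiveDefinite fun Z : Matrix (Fin n) (Fin n) ℂ => matNorm κ d Z ^ d := by
  have hM := isNorm_matNorm hN hd hd2 hh
  refine ⟨?_, fun Z hZ => pow_pos (lt_of_le_of_ne (hM.nonneg Z) fun h0 => ?_) d⟩
  · simp_rw [matNorm_pow hN hd hd2 hh]
    exact continuous_finsetSum _ fun π _ =>
      ((continuous_tracePart_re hd π).const_mul _).div_const _
  · exact hZ ((hM.eq_zero_iff Z).1 h0.symm)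

theorem isTracePolynomial_matNorm_pow (hN : IsNorm ℝ h) (hd : Even d) (hd2 : 2 ≤ d)
    (hh : ∀ A, h A ^ d =
      ∑ π : Nat.Partition d, kappaPart κ π * psumPart π (eig A) / (yPart π : ℝ)) :
    IsTracePolynomial fun Z : Matrix (Fin n) (Fin n) ℂ => matNorm κ d Z ^ d := by
  simp_rw [matNorm_pow hN hd hd2 hh, mul_div_right_comm]
  exact isTracePolynomial_sum_tracePart hd _

end MatrixNorm

end RandomNorm

theorem theorem1 {Ω : Type*} [MeasurableSpace Ω] (P : Measure Ω) [IsProbabilityMeasure P]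
    (n : ℕ) [NeZero n] (X : Fin n → Ω → ℝ) (d : ℝ) (hd : 2 ≤ d)
    (hmeas : ∀ i, Measurable (X i))
    (hLd : ∀ i, MemLp (X i) (ENNReal.ofReal d) P)
    (hnondeg : ∀ i, ∀ c : ℝ, ¬ (X i =ᵐ[P] fun _ => c))
    (hindep : iIndepFun X P)
    (hident : ∀ i j, IdentDistrib (X i) (X j) P P) :
    -- (a)
    ((∀ A : RandomNorm.Herm n,
        Integrable (fun ω => |RandomNorm.pairing X (RandomNorm.eig A) ω| ^ d) P) ∧
      RandomNorm.IsNorm ℝ (RandomNorm.hermNorm P X d)) ∧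
    -- (b)
    (∀ m : ℕ, Even m → (m : ℝ) = d → 0 ∈ interior (integrableExpSet (X 0) P) →
      (∀ A : RandomNorm.Herm n,
        0 ∈ interior (integrableExpSet (RandomNorm.pairing X (RandomNorm.eig A)) P) ∧
        (∀ t : ℝ, mgf (RandomNorm.pairing X (RandomNorm.eig A)) P t =
          ∏ i, mgf (X 0) P (RandomNorm.eig A i * t)) ∧
        RandomNorm.HasPowerSeriesCoeff
          (fun t => ∏ i, mgf (X 0) P (RandomNorm.eig A i * t)) m
          (RandomNorm.hermNorm P X d A ^ m)) ∧
      ∃ p : MvPolynomial (Fin n) ℝ, p.IsSymmetric ∧ p.IsHomogeneous m ∧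
        RandomNorm.IsPositiveDefinite (fun x : Fin n → ℝ => MvPolynomial.eval x p) ∧
        ∀ A : RandomNorm.Herm n,
          RandomNorm.hermNorm P X d A ^ m = MvPolynomial.eval (RandomNorm.eig A) p) ∧
    -- (c)
    (∀ m : ℕ, Even m → (m : ℝ) = d → ∀ A : RandomNorm.Herm n,
      ((RandomNorm.hermNorm P X d A ^ m : ℝ) : ℂ) =
        1 / (m ! : ℂ) * RandomNorm.bell m (fun j =>
          (RandomNorm.cumulant P (X 0) j : ℂ) *
            ((A : Matrix (Fin n) (Fin n) ℂ) ^ j).trace) ∧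
      (∀ π : Nat.Partition m, (RandomNorm.psumPart π (RandomNorm.eig A) : ℂ) =
        (π.parts.map fun k => ((A : Matrix (Fin n) (Fin n) ℂ) ^ k).trace).prod) ∧
      RandomNorm.hermNorm P X d A ^ m =
        ∑ π : Nat.Partition m, RandomNorm.kappaPart (RandomNorm.cumulant P (X 0)) π *
          RandomNorm.psumPart π (RandomNorm.eig A) / (RandomNorm.yPart π : ℝ)) ∧
    -- (d)
    (RandomNorm.SchurConvex (RandomNorm.vecNorm P X d) ∧
      ∀ A B : RandomNorm.Herm n,
        RandomNorm.Majorizes (RandomNorm.eig B) (RandomNorm.eig A) →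
          RandomNorm.hermNorm P X d A ≤ RandomNorm.hermNorm P X d B) ∧
    -- (e)
    (∀ m : ℕ, Even m → (m : ℝ) = d →
      (∀ (π : Nat.Partition m) (Z : Matrix (Fin n) (Fin n) ℂ),
        (RandomNorm.tracePart π Z).im = 0) ∧
      RandomNorm.IsNorm ℂ
        (fun Z : Matrix (Fin n) (Fin n) ℂ =>
          RandomNorm.matNorm (RandomNorm.cumulant P (X 0)) m Z) ∧
      (∀ A : RandomNorm.Herm n,
        RandomNorm.matNorm (RandomNorm.cumulant P (X 0)) m (A : Matrix (Fin n) (Fin n) ℂ) =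
          RandomNorm.hermNorm P X d A) ∧
      (∀ Z : Matrix (Fin n) (Fin n) ℂ,
        RandomNorm.matNorm (RandomNorm.cumulant P (X 0)) m Z ^ m =
          ∑ π : Nat.Partition m, RandomNorm.kappaPart (RandomNorm.cumulant P (X 0)) π *
            (RandomNorm.tracePart π Z).re / (RandomNorm.yPart π : ℝ)) ∧
      RandomNorm.IsPositiveDefinite
        (fun Z : Matrix (Fin n) (Fin n) ℂ =>
          RandomNorm.matNorm (RandomNorm.cumulant P (X 0)) m Z ^ m) ∧
      RandomNorm.IsTracePolynomial
        (fun Z : Matrix (Fin n) (Fin n) ℂ =>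
          RandomNorm.matNorm (RandomNorm.cumulant P (X 0)) m Z ^ m)) := by
  have hN := RandomNorm.isNorm_vecNorm hd hLd hnondeg hindep
  have hperm := RandomNorm.vecNorm_comp_perm hindep hident d
  have hH : RandomNorm.IsNorm ℝ (RandomNorm.hermNorm P X d) := hN.isNorm_comp_eig hperm
  have hschur := hN.schurConvex hperm
  have hpow : ∀ m : ℕ, Even m → (m : ℝ) = d → ∀ x : Fin n → ℝ,
      RandomNorm.vecNorm P X d x ^ m =
        (∫ ω, RandomNorm.pairing X x ω ^ m ∂P) / (m ! : ℝ) := by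
    rintro m hm rfl x
    exact RandomNorm.vecNorm_pow_eq hm (by rintro rfl; norm_num at hd) x
  -- Needed for all vectors and not only for spectra, because the positivity in (b) concerns the
  -- polynomial on all of `ℝⁿ`.
  have hpart : ∀ m : ℕ, Even m → (m : ℝ) = d → ∀ x : Fin n → ℝ,
      RandomNorm.vecNorm P X d x ^ m =
        ∑ π : Nat.Partition m, RandomNorm.kappaPart (RandomNorm.cumulant P (X 0)) π *
          RandomNorm.psumPart π x / (RandomNorm.yPart π : ℝ) := by
    intro m hm hmd x
    rw [hpow m hm hmd]
    subst hmd
    exact RandomNorm.integral_pairing_pow_eq_sum_partitions hmeas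
      (fun i => by simpa using hLd i) hindep (fun i => hident i 0) x
  refine ⟨⟨fun A => RandomNorm.integrable_abs_pairing_rpow (by linarith) hLd _, hH⟩, ?_, ?_,
    ⟨hschur, fun A B h => hschur _ _ h⟩, ?_⟩
  · intro m hm hmd hexp
    refine ⟨fun A => ?_,
      RandomNorm.normPolynomial n (RandomNorm.cumulant P (X 0)) m,
      RandomNorm.normPolynomial_isSymmetric _ _ _,
      RandomNorm.normPolynomial_isHomogeneous _ _ _,
      ⟨MvPolynomial.continuous_eval _, fun x hx => ?_⟩, fun A => ?_⟩
    · have hint := RandomNorm.zero_mem_interior_integrableExpSet_pairing hmeas hindep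
        (fun i => hident i 0) hexp (RandomNorm.eig A)
      have hmgf := RandomNorm.mgf_pairing hmeas hindep (fun i => hident i 0) (RandomNorm.eig A)
      refine ⟨hint, hmgf, ?_⟩
      rw [RandomNorm.hermNorm, hpow m hm hmd, ← funext hmgf]
      exact RandomNorm.hasPowerSeriesCoeff_mgf hint m
    · simp only [RandomNorm.eval_normPolynomial, ← hpart m hm hmd]
      exact pow_pos (lt_of_le_of_ne (hN.nonneg x) fun h0 => hx ((hN.eq_zero_iff x).1 h0.symm)) m
    · rw [RandomNorm.eval_normPolynomial]
      exact hpart m hm hmd _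
  · intro m hm hmd A
    refine ⟨?_, fun π => RandomNorm.psumPart_eig π A, hpart m hm hmd _⟩
    rw [RandomNorm.bell_traces_eq, RandomNorm.hermNorm, hpart m hm hmd]
  · intro m hm hmd
    have hm2 : 2 ≤ m := by rw [← hmd] at hd; exact_mod_cast hd
    have hh := fun A : RandomNorm.Herm n => hpart m hm hmd (RandomNorm.eig A)
    exact ⟨fun π Z => RandomNorm.tracePart_im hm π Z,
      RandomNorm.isNorm_matNorm hH hm hm2 hh,
      fun A => RandomNorm.matNorm_hermitian hH hm2 hh A,
      fun Z => RandomNorm.matNorm_pow hH hm hm2 hh Z,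
      RandomNorm.isPositiveDefinite_matNorm_pow hH hm hm2 hh,
      RandomNorm.isTracePolynomial_matNorm_pow hH hm hm2 hh⟩
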